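/- Let $d\ge 2$ and let $G$ be a probability measure on $\mathbb{R}$ for which there are $0<a<b$ and $\alpha>0$ such that $G$ is supported on $[a,b]$ and is absolutely continuous with a density $\rho$ satisfying $\rho(x)\ge\alpha$ for almost every $x\in[a,b]$. Consider first-passage percolation on $\mathbb{Z}^d$: the nearest-neighbour edges $e$ carry i.i.d. weights $t_e$ with law $G$, a finite path $p$ has passage time $T(p)=\sum_{e\in p}t_e$, and $\gamma(0,v)$ denotes the almost surely unique geodesic from $0$ to $v$, that is, the path from $0$ to $v$ of minimal passage time. Let $\|\cdot\|$ and $(\cdot,\cdot)$ be the Euclidean norm and inner product on $\mathbb{R}^d$, and for $u\in\mathbb{R}^d$ and $r>0$ let $\mathrm{cyl}(0,u,r)=\{w\in\mathbb{R}^d:\ \|w-\lambda u\|\le r\text{ for some }\lambda\in\mathbb{R}\}$. Then there exist $c>0$ and $n_0\ge 1$, depending only on $d$ and $G$, such that for all $v\in\mathbb{Z}^d$ with $\|v\|\ge n_0$ and all real $\ell$ with $(\log\|v\|)^{d+2}\le\ell\le\|v\|$, $$\mathbb{E}\Big(\big|\{u\in\gamma(0,v):\ 0\le(u,\hat v)\le\ell\}\setminus\mathrm{cyl}\big(0,v,c\,\ell^{\frac1{d+1}}\big)\big|\Big)\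 \ge\ \frac{\ell}{2},\qquad \hat v:=\frac{v}{\|v\|},$$ where $u$ ranges over the vertices of $\gamma(0,v)$. In particular, for all $v\in\mathbb{Z}^d$ with $\|v\|\ge n_0$, the expected number of vertices of $\gamma(0,v)$ outside $\mathrm{cyl}\big(0,v,c\|v\|^{\frac1{d+1}}\big)$ is at least $\|v\|/2$. -/

import Mathlib

open MeasureTheory ProbabilityTheory

namespace FPP

/-- The hypercubic lattice `ℤ^d` with nearest-neighbour edges. -/
def lattice (d : ℕ) : SimpleGraph (Fin d → ℤ) where
  Adj x y := ∑ i, |x i - y i| = 1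
  symm := ⟨fun x y h => by simpa only [abs_sub_comm] using h⟩
  loopless := ⟨fun x h => by simp at h⟩

/-- The edge set `E(ℤ^d)`. -/
abbrev Edge (d : ℕ) : Type := (lattice d).edgeSet

/-- The passage time `T(p) = ∑_{e ∈ p} t_e` of a finite path in the environment `t`. -/
def passageTime {d : ℕ} (t : Edge d → ℝ) {x y : Fin d → ℤ} (p : (lattice d).Walk x y) : ℝ :=
  (p.darts.map fun a => t ⟨a.edge, a.edge_mem⟩).sum

/-- A geodesic: a path from `x` to `y` achieving the minimal passage time among all finite
paths from `x` to `y`. -/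
def IsGeodesic {d : ℕ} (t : Edge d → ℝ) {x y : Fin d → ℤ} (p : (lattice d).Walk x y) : Prop :=
  ∀ q : (lattice d).Walk x y, passageTime t p ≤ passageTime t q

/-- The vertices of the geodesic `γ(x, y)`: the vertices of the unique geodesic from `x` to `y`
(the empty set in environments where there is no geodesic or more than one). -/
def geodesicVertices {d : ℕ} (t : Edge d → ℝ) (x y : Fin d → ℤ) : Set (Fin d → ℤ) :=
  {u | ∃ p : (lattice d).Walk x y,
    IsGeodesic t p ∧ (∀ q : (lattice d).Walk x y, IsGeodesic t q → q = p) ∧ u ∈ p.support}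

/-- A lattice point, seen in `ℝ^d` with the `ℓ²` norm. -/
def toEuclid {d : ℕ} (x : Fin d → ℤ) : EuclideanSpace ℝ (Fin d) :=
  WithLp.toLp 2 fun i => (x i : ℝ)

/-- `cyl(0, u, r)`: the infinite cylinder of radius `r` around the line through `0` and `u`. -/
def cyl {d : ℕ} (u : EuclideanSpace ℝ (Fin d)) (r : ℝ) : Set (EuclideanSpace ℝ (Fin d)) :=
  {w | ∃ s : ℝ, ‖w - s • u‖ ≤ r}

/-- The assumption on the weight distribution: for some `0 < a < b` and `α > 0`, `G` is supported
on `[a, b]` and has a Lebesgue density `ρ` with `ρ ≥ α` almost everywhere on `[a, b]`. -/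
def WeightAssumption (G : Measure ℝ) : Prop :=
  ∃ a b α : ℝ, 0 < a ∧ a < b ∧ 0 < α ∧ G (Set.Icc a b)ᶜ = 0 ∧
    ∃ ρ : ℝ → ENNReal, Measurable ρ ∧ G = volume.withDensity ρ ∧
      ∀ᵐ x ∂(volume.restrict (Set.Icc a b)), ENNReal.ofReal α ≤ ρ x

end FPP

/-!
Suppose that the geodesic `γ(0, v)` is expected to have at most `ℓ / 2` vertices in the slab
`0 ≤ (u, v̂) ≤ ℓ` outside the cylinder of radius `r`. Since it crosses the slab, with probability at
least `1 / 3` it has about `ℓ / 4` vertices inside the cylinder. On the other hand, among `m`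
disjoint lattice translates of the cylinder there is one which `γ(0, v)` visits at most `ℓ / (2 m)`
times on average; by translation invariance `γ(w, v + w)`, for some `w` of length at most `4 m r`,
rarely visits the cylinder itself.

These two events are brought together by a Mermin–Wagner argument. The density of each of the
`O(ℓ r ^ (d - 1))` weights in the cylinder is tilted by a relative amount `τ` with
`τ ^ 2 ≈ 1 / (ℓ r ^ (d - 1))`, which keeps the second moment of the Radon–Nikodym derivative
bounded, so that the tilted environment still behaves well with positive probability. A map which
undoes the tilt decreases the weights in the cylinder by an amount of order `τ`, so it lowers the
passage time of `γ(0, v)` by at least `κ τ ℓ` and that of `γ(w, v + w)` by at most `τ ℓ / (α m)`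
up to constants, while the two passage times differ by `O(m r)` in every environment. For `m`
large this forces `τ ℓ = O(r)`, that is `ℓ = O(r ^ (d + 1))`, which fails for
`r = c ℓ ^ (1 / (d + 1))` with `c` small.
-/

namespace FPP

/-! ### Walks in a graph -/

section Walk

variable {V : Type*} {Γ : SimpleGraph V} {x y : V}

/-- The edges of a walk in the order in which they are traversed, as elements of the index type
of the weights rather than of `Sym2 V`. -/
def edgeList (p : Γ.Walk x y) : List Γ.edgeSet :=
  p.darts.map fun a => ⟨a.edge, a.edge_mem⟩

theorem map_val_edgeList (p : Γ.Walk x y) : (edgeList p).map Subtype.val = p.edges := by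
  simp [edgeList, Function.comp_def, SimpleGraph.Walk.edges]

theorem mem_edgeList {p : Γ.Walk x y} {e : Γ.edgeSet} :
    e ∈ edgeList p ↔ (e : Sym2 V) ∈ p.edges := by
  simp [← map_val_edgeList]

@[simp]
theorem length_edgeList (p : Γ.Walk x y) : (edgeList p).length = p.length := by
  simp [edgeList]

theorem edgeList_injective : Function.Injective (edgeList : Γ.Walk x y → List Γ.edgeSet) :=
  fun p q h => SimpleGraph.Walk.edges_injective <| by
    rw [← map_val_edgeList, ← map_val_edgeList, h]

theorem nodup_edgeList {p : Γ.Walk x y} (hp : p.IsPath) : (edgeList p).Nodup :=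
  .of_map Subtype.val <| by simpa only [map_val_edgeList] using hp.isTrail.edges_nodup

theorem edgeList_take (p : Γ.Walk x y) (n : ℕ) : edgeList (p.take n) = (edgeList p).take n := by
  simp [edgeList, SimpleGraph.Walk.darts_take, List.map_take]

theorem edgeList_drop (p : Γ.Walk x y) (n : ℕ) : edgeList (p.drop n) = (edgeList p).drop n := by
  simp [edgeList, SimpleGraph.Walk.darts_drop, List.map_drop]

theorem eq_of_edges_subset_of_isPath {p q : Γ.Walk x y} (hp : p.IsPath) (hq : q.IsPath)
    (h : q.edges ⊆ p.edges) : q = p := by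
  induction q with
  | nil => exact (SimpleGraph.Walk.isPath_iff_nil.1 hp).eq_nil.symm
  | @cons u v w huv q ih =>
    cases p with
    | nil => exact absurd (h (List.mem_cons_self ..)) List.not_mem_nil
    | @cons _ v' _ huv' p =>
      rw [SimpleGraph.Walk.cons_isPath_iff] at hp hq
      simp only [SimpleGraph.Walk.edges_cons, List.cons_subset, List.mem_cons] at h
      obtain rfl : v = v' := by
        rcases h.1 with hv | hv
        · simpa [huv.ne, huv'.ne] using hv
        · exact absurd (p.fst_mem_support_of_mem_edges hv) hp.2
      rw [ih hp.1 hq.1 fun e he => (List.mem_cons.1 (h.2 he)).resolve_left ?_]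
      rintro rfl
      exact hq.2 (q.fst_mem_support_of_mem_edges he)

section EdgeLists

variable [Γ.LocallyFinite]

variable (Γ) in
open Classical in
/-- The edge lists of the walks of length at most `n` starting at `x`. -/
noncomputable def edgeLists : ℕ → V → Finset (List Γ.edgeSet)
  | 0, _ => {[]}
  | n + 1, x => insert [] <| (Γ.neighborFinset x).attach.biUnion fun y =>
      (edgeLists n y).image (⟨s(x, y), (Γ.mem_neighborFinset x y).1 y.2⟩ :: ·)

theorem edgeList_mem_edgeLists (p : Γ.Walk x y) {n : ℕ} (hp : p.length ≤ n) :
    edgeList p ∈ edgeLists Γ n x := by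
  classical
  induction p generalizing n with
  | nil => cases n <;> simp [edgeList, edgeLists]
  | @cons u v w h p ih =>
    obtain ⟨n, rfl⟩ := Nat.exists_eq_add_one_of_ne_zero (Nat.ne_zero_of_lt hp)
    rw [edgeLists, Finset.mem_insert, Finset.mem_biUnion]
    exact .inr ⟨⟨v, (Γ.mem_neighborFinset u v).2 h⟩, Finset.mem_attach _ _,
      Finset.mem_image_of_mem _ (ih (Nat.le_of_succ_le_succ hp))⟩

theorem card_edgeLists_le {Δ : ℕ} (hΔ : ∀ x, Γ.degree x ≤ Δ) (n : ℕ) (x : V) :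
    (edgeLists Γ n x).card ≤ (Δ + 1) ^ n := by
  classical
  induction n generalizing x with
  | zero => simp [edgeLists]
  | succ n ih =>
    have hunion := Finset.card_biUnion_le_card_mul (Γ.neighborFinset x).attach
      (fun y => (edgeLists Γ n y).image (⟨s(x, y), (Γ.mem_neighborFinset x y).1 y.2⟩ :: ·))
      ((Δ + 1) ^ n) fun y _ => Finset.card_image_le.trans (ih y)
    rw [Finset.card_attach, SimpleGraph.card_neighborFinset_eq_degree] at hunion
    calc (edgeLists Γ (n + 1) x).card ≤ Γ.degree x * (Δ + 1) ^ n + 1 :=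
          (Finset.card_insert_le _ _).trans (by gcongr)
      _ ≤ Δ * (Δ + 1) ^ n + (Δ + 1) ^ n := by gcongr; exacts [hΔ x, Nat.one_le_pow' _ _]
      _ = (Δ + 1) ^ (n + 1) := by ring

theorem length_le_of_mem_edgeLists {n : ℕ} {l : List Γ.edgeSet} (hl : l ∈ edgeLists Γ n x) :
    l.length ≤ n := by
  induction n generalizing x l with
  | zero => simp_all [edgeLists]
  | succ n ih =>
    simp only [edgeLists, Finset.mem_insert, Finset.mem_biUnion, Finset.mem_image] at hl
    obtain rfl | ⟨y, -, l, hl, rfl⟩ := hl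
    · exact Nat.zero_le _
    · exact Nat.succ_le_succ (ih hl)

end EdgeLists

/-- The edges having an endpoint in `S`. -/
def touching (Γ : SimpleGraph V) (S : Set V) : Set Γ.edgeSet :=
  {e | ∃ u ∈ S, u ∈ (e : Sym2 V)}

theorem edge_mem_touching_iff {S : Set V} (a : Γ.Dart) :
    (⟨a.edge, a.edge_mem⟩ : Γ.edgeSet) ∈ touching Γ S ↔ a.fst ∈ S ∨ a.snd ∈ S := by
  simp [touching, SimpleGraph.Dart.edge, and_or_left, exists_or]

section Counting

open Classical in
theorem ncard_setOf_mem_inter {l : List V} (hl : l.Nodup) (S : Set V) :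
    ({u | u ∈ l} ∩ S).ncard = l.countP (· ∈ S) := by
  have h : {u | u ∈ l} ∩ S = ((l.filter (· ∈ S)).toFinset : Set V) := by ext; simp
  rw [h, Set.ncard_coe_finset, List.toFinset_card_of_nodup (hl.filter _),
    List.countP_eq_length_filter]

open Classical in
theorem countP_support_le (p : Γ.Walk x y) (S : Set V) :
    p.support.countP (· ∈ S) ≤ (edgeList p).countP (· ∈ touching Γ S) + 1 := by
  rw [← p.map_fst_darts_append, List.countP_append, List.countP_map, edgeList, List.countP_map]
  refine Nat.add_le_add (List.countP_mono_left fun a _ ha => ?_) List.countP_le_length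
  simp_all [edge_mem_touching_iff]

open Classical in
theorem countP_touching_le (p : Γ.Walk x y) (S : Set V) :
    (edgeList p).countP (· ∈ touching Γ S) ≤ 2 * p.support.countP (· ∈ S) := by
  have hfst : p.darts.countP (fun a => a.fst ∈ S) ≤ p.support.countP (· ∈ S) := by
    rw [← p.map_fst_darts_append, List.countP_append, List.countP_map]
    exact Nat.le_add_right _ _
  have hsnd : p.darts.countP (fun a => a.snd ∈ S) ≤ p.support.countP (· ∈ S) := by
    rw [← p.cons_map_snd_darts, List.countP_cons, List.countP_map]
    exact Nat.le_add_right _ _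
  have hor : ∀ l : List Γ.Dart, l.countP (fun a => a.fst ∈ S ∨ a.snd ∈ S) ≤
      l.countP (fun a => a.fst ∈ S) + l.countP (fun a => a.snd ∈ S) := fun l => by
    induction l with
    | nil => simp
    | cons a l ih => simp only [List.countP_cons]; grind
  rw [edgeList, List.countP_map]
  simp only [Function.comp_def, edge_mem_touching_iff]
  linarith [hor p.darts]

end Counting

theorem exists_mem_support_mem_Ico (p : Γ.Walk x y) {f : V → ℝ}
    (hf : ∀ u v, Γ.Adj u v → f v ≤ f u + 1) {a : ℝ} (hx : f x < a + 1) (hy : a ≤ f y) :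
    ∃ u ∈ p.support, f u ∈ Set.Ico a (a + 1) := by
  induction p with
  | nil => exact ⟨_, List.mem_singleton_self _, hy, hx⟩
  | @cons u v w h p ih =>
    rcases le_or_gt a (f u) with ha | ha
    · exact ⟨u, SimpleGraph.Walk.start_mem_support _, ha, hx⟩
    · obtain ⟨z, hz, hfz⟩ := ih (by linarith [hf u v h]) hy
      exact ⟨z, List.mem_cons_of_mem _ hz, hfz⟩

theorem le_ncard_support_inter_preimage_Icc (p : Γ.Walk x y) {f : V → ℝ}
    (hf : ∀ u v, Γ.Adj u v → f v ≤ f u + 1) {a b : ℝ} (hx : f x ≤ a) (hy : b ≤ f y) :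
    b - a - 1 ≤ ({u | u ∈ p.support} ∩ f ⁻¹' Set.Icc a b).ncard := by
  set A := {u | u ∈ p.support} ∩ f ⁻¹' Set.Icc a b
  have hfin : A.Finite := (List.finite_toSet _).subset Set.inter_subset_left
  have hsub : (Finset.range ⌊b - a⌋₊ : Set ℕ) ⊆ (fun u => ⌊f u - a⌋₊) '' A := by
    intro j hj
    have hj' : (j : ℝ) + 1 ≤ b - a := by
      exact_mod_cast (Nat.le_floor_iff' j.succ_ne_zero).1 (Finset.mem_range.1 hj)
    have : (0 : ℝ) ≤ j := j.cast_nonneg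
    obtain ⟨u, hu, hle, hlt⟩ := exists_mem_support_mem_Ico p hf (a := a + j)
      (by linarith) (by linarith)
    exact ⟨u, ⟨hu, by linarith, by linarith⟩,
      (Nat.floor_eq_iff (by linarith)).2 ⟨by linarith, by linarith⟩⟩
  have hcard : ⌊b - a⌋₊ ≤ A.ncard := by
    calc ⌊b - a⌋₊ = (Finset.range ⌊b - a⌋₊ : Set ℕ).ncard := by
          rw [Set.ncard_coe_finset, Finset.card_range]
      _ ≤ _ := Set.ncard_le_ncard hsub (hfin.image _)
      _ ≤ A.ncard := Set.ncard_image_le hfin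
  have hcard' : (⌊b - a⌋₊ : ℝ) ≤ A.ncard := by exact_mod_cast hcard
  linarith [Nat.lt_floor_add_one (b - a)]

end Walk

/-! ### Geodesics of a fixed environment -/

section FixedEnvironment

variable {d : ℕ}

/-- The `ℓ¹` norm on `ℤ^d`, which is the graph distance to the origin. -/
def l1Norm (x : Fin d → ℤ) : ℕ := ∑ i, (x i).natAbs

theorem cast_l1Norm (x : Fin d → ℤ) : (l1Norm x : ℝ) = ∑ i, |(x i : ℝ)| := by
  simp [l1Norm, Nat.cast_natAbs]

@[simp]
theorem l1Norm_neg (x : Fin d → ℤ) : l1Norm (-x) = l1Norm x := by simp [l1Norm]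

theorem l1Norm_sub_comm (x y : Fin d → ℤ) : l1Norm (x - y) = l1Norm (y - x) := by
  rw [← l1Norm_neg, neg_sub]

theorem l1Norm_eq_zero {x : Fin d → ℤ} : l1Norm x = 0 ↔ x = 0 := by
  simp [l1Norm, funext_iff]

theorem adj_iff_l1Norm {x y : Fin d → ℤ} : (lattice d).Adj x y ↔ l1Norm (x - y) = 1 := by
  change ∑ i, |x i - y i| = 1 ↔ _
  simp only [l1Norm, Pi.sub_apply, Int.abs_eq_natAbs]
  norm_cast

theorem exists_adj_l1Norm_add_one {x y : Fin d → ℤ} (hxy : x ≠ y) :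
    ∃ z, (lattice d).Adj x z ∧ l1Norm (z - y) + 1 = l1Norm (x - y) := by
  obtain ⟨i, hi⟩ := Function.ne_iff.1 hxy
  let z := Function.update x i (if x i < y i then x i + 1 else x i - 1)
  have hz : ∀ j ∈ Finset.univ.erase i, z j = x j := fun j hj =>
    Function.update_of_ne (Finset.ne_of_mem_erase hj) ..
  have hzi : z i = if x i < y i then x i + 1 else x i - 1 := Function.update_self ..
  refine ⟨z, adj_iff_l1Norm.2 ?_, ?_⟩
  · rw [l1Norm, ← Finset.add_sum_erase _ _ (Finset.mem_univ i), Finset.sum_eq_zero]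
    · simp only [Pi.sub_apply, hzi]; grind
    · intro j hj
      simp [hz j hj]
  · rw [l1Norm, l1Norm, ← Finset.add_sum_erase _ _ (Finset.mem_univ i),
      ← Finset.add_sum_erase _ _ (Finset.mem_univ i),
      Finset.sum_congr rfl fun j hj => by rw [Pi.sub_apply, hz j hj, ← Pi.sub_apply]]
    simp only [Pi.sub_apply, hzi]
    grind

theorem exists_walk_length_eq_l1Norm (x y : Fin d → ℤ) :
    ∃ p : (lattice d).Walk x y, p.length = l1Norm (x - y) := by
  induction hn : l1Norm (x - y) generalizing x with
  | zero =>
    obtain rfl : x = y := sub_eq_zero.1 (l1Norm_eq_zero.1 hn)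
    exact ⟨.nil, rfl⟩
  | succ n ih =>
    have hxy : x ≠ y := by
      rintro rfl
      simp [l1Norm] at hn
    obtain ⟨z, hxz, hz⟩ := exists_adj_l1Norm_add_one hxy
    obtain ⟨p, hp⟩ := ih z (by lia)
    exact ⟨.cons hxz p, by rw [SimpleGraph.Walk.length_cons, hp]⟩

/-- The sites at distance at most `1` of `x` in the supremum norm. -/
noncomputable def box (x : Fin d → ℤ) : Finset (Fin d → ℤ) :=
  Finset.Icc (x - 1) (x + 1)

theorem card_box (x : Fin d → ℤ) : (box x).card = 3 ^ d := by
  have h : ∀ i, (x i + 1 + 1 - (x i - 1)).toNat = 3 := fun i => by lia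
  simp [box, Pi.card_Icc, h]

theorem neighborSet_subset_box (x : Fin d → ℤ) : (lattice d).neighborSet x ⊆ box x := by
  intro y hxy
  have hle : ∀ i, (x i - y i).natAbs ≤ 1 := fun i =>
    (adj_iff_l1Norm.1 hxy) ▸ Finset.single_le_sum (f := fun i => ((x - y) i).natAbs)
      (fun _ _ => Nat.zero_le _) (Finset.mem_univ i)
  simp only [box, Finset.coe_Icc, Set.mem_Icc, Pi.le_def, Pi.sub_apply, Pi.add_apply, Pi.one_apply]
  exact ⟨fun i => by have := hle i; lia, fun i => by have := hle i; lia⟩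

noncomputable instance : (lattice d).LocallyFinite := fun x =>
  ((box x).finite_toSet.subset (neighborSet_subset_box x)).fintype

theorem degree_le (x : Fin d → ℤ) : (lattice d).degree x ≤ 3 ^ d := by
  rw [← card_box x, ← SimpleGraph.card_neighborFinset_eq_degree]
  refine Finset.card_le_card fun y hy => neighborSet_subset_box x ?_
  simpa using hy

instance : Countable (Edge d) := Subtype.countable

instance (x y : Fin d → ℤ) : Countable ((lattice d).Walk x y) :=
  edgeList_injective.countable

theorem passageTime_eq_sum_edgeList (t : Edge d → ℝ) {x y : Fin d → ℤ}
    (p : (lattice d).Walk x y) : passageTime t p = ((edgeList p).map t).sum := by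
  simp [passageTime, edgeList, Function.comp_def]

theorem passageTime_append (t : Edge d → ℝ) {x y z : Fin d → ℤ} (p : (lattice d).Walk x y)
    (q : (lattice d).Walk y z) :
    passageTime t (p.append q) = passageTime t p + passageTime t q := by
  simp [passageTime]

theorem passageTime_take_add_drop (t : Edge d → ℝ) {x y : Fin d → ℤ} (p : (lattice d).Walk x y)
    (n : ℕ) : passageTime t (p.take n) + passageTime t (p.drop n) = passageTime t p := by
  simp only [passageTime_eq_sum_edgeList, edgeList_take, edgeList_drop, ← List.sum_append,
    ← List.map_append, List.take_append_drop]

theorem passageTime_sub_const (t : Edge d → ℝ) (a : ℝ) {x y : Fin d → ℤ}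
    (p : (lattice d).Walk x y) :
    passageTime (fun e => t e - a) p = passageTime t p - a * p.length := by
  simp only [passageTime_eq_sum_edgeList, ← length_edgeList p, mul_comm a]
  induction edgeList p with
  | nil => simp
  | cons e l ih =>
    simp only [List.map_cons, List.sum_cons, ih, List.length_cons, Nat.cast_add, Nat.cast_one]
    ring

theorem passageTime_nonneg {t : Edge d → ℝ} (ht : ∀ e, 0 ≤ t e) {x y : Fin d → ℤ}
    (p : (lattice d).Walk x y) : 0 ≤ passageTime t p := by
  rw [passageTime_eq_sum_edgeList]
  exact List.sum_nonneg <| List.forall_mem_map.2 fun e _ => ht e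

theorem mul_length_le_passageTime {t : Edge d → ℝ} {a : ℝ} (ht : ∀ e, a ≤ t e) {x y : Fin d → ℤ}
    (p : (lattice d).Walk x y) : a * p.length ≤ passageTime t p := by
  have := passageTime_nonneg (fun e => sub_nonneg.2 (ht e)) p
  rwa [passageTime_sub_const, sub_nonneg] at this

theorem passageTime_le_mul_length {t : Edge d → ℝ} {b : ℝ} (ht : ∀ e, t e ≤ b) {x y : Fin d → ℤ}
    (p : (lattice d).Walk x y) : passageTime t p ≤ b * p.length := by
  simpa using List.sum_le_card_nsmul ((edgeList p).map t) b
    (List.forall_mem_map.2 fun e _ => ht e) |>.trans_eq (by simp [mul_comm])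
    |> (passageTime_eq_sum_edgeList t p).trans_le

theorem passageTime_bypass_le {t : Edge d → ℝ} (ht : ∀ e, 0 ≤ t e) {x y : Fin d → ℤ}
    (p : (lattice d).Walk x y) : passageTime t p.bypass ≤ passageTime t p :=
  (p.darts_bypass_sublist_darts.map _).sum_le_sum <| List.forall_mem_map.2 fun _ _ => ht _

theorem exists_isGeodesic {t : Edge d → ℝ} {a : ℝ} (ha : 0 < a) (ht : ∀ e, a ≤ t e)
    (x y : Fin d → ℤ) : ∃ p : (lattice d).Walk x y, IsGeodesic t p := by
  obtain ⟨p₀, -⟩ := exists_walk_length_eq_l1Norm x y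
  have hfin : {p : (lattice d).Walk x y | passageTime t p ≤ passageTime t p₀}.Finite := by
    refine ((lattice d).finsetWalkLengthLT (⌊passageTime t p₀ / a⌋₊ + 1) x y).finite_toSet.subset
      fun p (hp : passageTime t p ≤ _) => ?_
    rw [Finset.mem_coe, SimpleGraph.mem_finsetWalkLengthLT_iff, Nat.lt_succ_iff]
    refine Nat.le_floor ((le_div_iff₀' ha).2 ((mul_length_le_passageTime ht p).trans hp))
  obtain ⟨p, hp, hmin⟩ := Set.exists_min_image _ (passageTime t) hfin
    ⟨p₀, le_refl (passageTime t p₀)⟩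
  exact ⟨p, fun q => (le_total (passageTime t q) (passageTime t p₀)).elim (hmin q) hp.trans⟩

theorem IsGeodesic.isPath {t : Edge d → ℝ} {a : ℝ} (ha : 0 < a) (ht : ∀ e, a ≤ t e)
    {x y : Fin d → ℤ} {p : (lattice d).Walk x y} (hp : IsGeodesic t p) : p.IsPath := by
  have hexcess := passageTime_bypass_le (fun e => sub_nonneg.2 (ht e)) p
  rw [passageTime_sub_const, passageTime_sub_const] at hexcess
  have hlen : (p.length : ℝ) ≤ p.bypass.length :=
    le_of_mul_le_mul_left (by linarith [hp p.bypass]) ha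
  rw [← SimpleGraph.Walk.bypass_eq_self_of_length_le_length_bypass p
    (show p.length ≤ p.bypass.length by exact_mod_cast hlen)]
  exact p.bypass_isPath

theorem IsGeodesic.passageTime_le {t : Edge d → ℝ} {b : ℝ} (ht : ∀ e, t e ≤ b)
    {x y : Fin d → ℤ} {p : (lattice d).Walk x y} (hp : IsGeodesic t p) :
    passageTime t p ≤ b * l1Norm (x - y) := by
  obtain ⟨q, hq⟩ := exists_walk_length_eq_l1Norm x y
  exact (hp q).trans (hq ▸ passageTime_le_mul_length ht q)

theorem IsGeodesic.passageTime_le_add {t : Edge d → ℝ} {b : ℝ} (ht : ∀ e, t e ≤ b)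
    {x y x' y' : Fin d → ℤ} {p : (lattice d).Walk x y} (hp : IsGeodesic t p)
    (q : (lattice d).Walk x' y') :
    passageTime t p ≤ passageTime t q + b * (l1Norm (x - x') + l1Norm (y' - y)) := by
  obtain ⟨r, hr⟩ := exists_walk_length_eq_l1Norm x x'
  obtain ⟨s, hs⟩ := exists_walk_length_eq_l1Norm y' y
  have hdetour := hp (r.append (q.append s))
  rw [passageTime_append, passageTime_append] at hdetour
  rw [← hr, ← hs]
  linarith [passageTime_le_mul_length ht r, passageTime_le_mul_length ht s]

theorem IsGeodesic.take {t : Edge d → ℝ} {x y : Fin d → ℤ} {p : (lattice d).Walk x y}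
    (hp : IsGeodesic t p) (n : ℕ) : IsGeodesic t (p.take n) := fun q => by
  have := hp (q.append (p.drop n))
  rw [passageTime_append, ← passageTime_take_add_drop t p n] at this
  linarith

theorem IsGeodesic.mul_le_of_getVert {t : Edge d → ℝ} {a b : ℝ} (hta : ∀ e, a ≤ t e)
    (htb : ∀ e, t e ≤ b) {x y : Fin d → ℤ} {p : (lattice d).Walk x y} (hp : IsGeodesic t p)
    {n : ℕ} (hn : n ≤ p.length) : a * n ≤ b * l1Norm (x - p.getVert n) := by
  have hlen : (p.take n).length = n := by rw [SimpleGraph.Walk.take_length, min_eq_left hn]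
  calc a * n = a * (p.take n).length := by rw [hlen]
    _ ≤ passageTime t (p.take n) := mul_length_le_passageTime hta _
    _ ≤ _ := (hp.take n).passageTime_le htb

/-- `p` is a geodesic, and the only one between its endpoints. -/
def IsUniqueGeodesic (t : Edge d → ℝ) {x y : Fin d → ℤ} (p : (lattice d).Walk x y) : Prop :=
  IsGeodesic t p ∧ ∀ q : (lattice d).Walk x y, IsGeodesic t q → q = p

/-- The number of vertices of the geodesic from `x` to `y` which belong to `S`. -/
noncomputable def geodesicCount (S : Set (Fin d → ℤ)) (x y : Fin d → ℤ) (t : Edge d → ℝ) : ℕ :=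
  (geodesicVertices t x y ∩ S).ncard

theorem geodesicVertices_eq_iUnion (t : Edge d → ℝ) (x y : Fin d → ℤ) :
    geodesicVertices t x y =
      ⋃ p : (lattice d).Walk x y, ⋃ _ : IsUniqueGeodesic t p, {u | u ∈ p.support} := by
  ext u
  simp [geodesicVertices, IsUniqueGeodesic, and_assoc]

theorem IsUniqueGeodesic.geodesicVertices_eq {t : Edge d → ℝ} {x y : Fin d → ℤ}
    {p : (lattice d).Walk x y} (hp : IsUniqueGeodesic t p) :
    geodesicVertices t x y = {u | u ∈ p.support} := by
  ext u
  refine ⟨?_, fun hu => ⟨p, hp.1, hp.2, hu⟩⟩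
  rintro ⟨q, hq, -, hu⟩
  rwa [hp.2 q hq] at hu

theorem finite_geodesicVertices (t : Edge d → ℝ) (x y : Fin d → ℤ) :
    (geodesicVertices t x y).Finite := by
  by_cases h : ∃ p : (lattice d).Walk x y, IsUniqueGeodesic t p
  · obtain ⟨p, hp⟩ := h
    rw [hp.geodesicVertices_eq]
    exact List.finite_toSet _
  · push Not at h
    simp [geodesicVertices_eq_iUnion, h]

theorem geodesicCount_union_le (S T : Set (Fin d → ℤ)) (x y : Fin d → ℤ) (t : Edge d → ℝ) :
    geodesicCount (S ∪ T) x y t ≤ geodesicCount S x y t + geodesicCount T x y t := by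
  rw [geodesicCount, Set.inter_union_distrib_left]
  exact Set.ncard_union_le _ _

theorem geodesicCount_mono {S T : Set (Fin d → ℤ)} (h : S ⊆ T) (x y : Fin d → ℤ)
    (t : Edge d → ℝ) : geodesicCount S x y t ≤ geodesicCount T x y t :=
  Set.ncard_le_ncard (Set.inter_subset_inter_right _ h)
    ((finite_geodesicVertices t x y).subset Set.inter_subset_left)

theorem sum_geodesicCount_le {ι : Type*} (s : Finset ι) {S : ι → Set (Fin d → ℤ)}
    (hS : (s : Set ι).PairwiseDisjoint S) {T : Set (Fin d → ℤ)} (hST : ∀ i ∈ s, S i ⊆ T)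
    (x y : Fin d → ℤ) (t : Edge d → ℝ) :
    ∑ i ∈ s, geodesicCount (S i) x y t ≤ geodesicCount T x y t := by
  have hfin : ∀ U, (geodesicVertices t x y ∩ U).Finite := fun U =>
    (finite_geodesicVertices t x y).subset Set.inter_subset_left
  calc ∑ i ∈ s, geodesicCount (S i) x y t
      = ∑ᶠ i ∈ (s : Set ι), (geodesicVertices t x y ∩ S i).ncard :=
        (finsum_mem_coe_finset _ _).symm
    _ = (⋃ i ∈ (s : Set ι), geodesicVertices t x y ∩ S i).ncard :=
        (Set.Finite.ncard_biUnion s.finite_toSet (fun i _ => hfin (S i))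
          fun i hi j hj hij => (hS hi hj hij).mono Set.inter_subset_right
            Set.inter_subset_right).symm
    _ ≤ geodesicCount T x y t := Set.ncard_le_ncard
        (Set.iUnion₂_subset fun i hi => Set.inter_subset_inter_right _ (hST i hi)) (hfin T)

@[fun_prop]
theorem measurable_passageTime {x y : Fin d → ℤ} (p : (lattice d).Walk x y) :
    Measurable fun t : Edge d → ℝ => passageTime t p := by
  simp only [passageTime_eq_sum_edgeList]
  induction edgeList p with
  | nil => simp
  | cons e l ih => simp only [List.map_cons, List.sum_cons]; fun_prop

theorem measurableSet_isUniqueGeodesic {x y : Fin d → ℤ} (p : (lattice d).Walk x y) :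
    MeasurableSet {t : Edge d → ℝ | IsUniqueGeodesic t p} := by
  have hgeod : ∀ q : (lattice d).Walk x y, Measurable fun t : Edge d → ℝ => IsGeodesic t q :=
    fun q => Measurable.forall fun r => measurableSet_setOfPred.1 <|
      measurableSet_le (measurable_passageTime q) (measurable_passageTime r)
  exact measurableSet_setOfPred.2 <|
    (hgeod p).and <| Measurable.forall fun q => (hgeod q).imp measurable_const

theorem measurable_geodesicCount (S : Set (Fin d → ℤ)) (x y : Fin d → ℤ) :
    Measurable (geodesicCount S x y) := by
  refine measurable_to_countable' fun k => ?_
  have hpre : geodesicCount S x y ⁻¹' {k} =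
      (⋃ p : (lattice d).Walk x y, {t | IsUniqueGeodesic t p} ∩
        {_t | ({u | u ∈ p.support} ∩ S).ncard = k}) ∪
      ((⋂ p : (lattice d).Walk x y, {t | IsUniqueGeodesic t p}ᶜ) ∩ {_t | k = 0}) := by
    ext t
    by_cases h : ∃ p : (lattice d).Walk x y, IsUniqueGeodesic t p
    · obtain ⟨p, hp⟩ := h
      have hq : ∀ q, IsUniqueGeodesic t q ↔ q = p := fun q => ⟨fun hq => hp.2 q hq.1, (· ▸ hp)⟩
      simp [geodesicCount, hp.geodesicVertices_eq, hq]
    · push Not at h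
      simp [geodesicCount, geodesicVertices_eq_iUnion, h, eq_comm]
  rw [hpre]
  refine (MeasurableSet.iUnion fun p => ?_).union ((MeasurableSet.iInter fun p => ?_).inter ?_)
  · exact (measurableSet_isUniqueGeodesic p).inter (MeasurableSet.const _)
  · exact (measurableSet_isUniqueGeodesic p).compl
  · exact MeasurableSet.const _

/-- An environment with weights in `[a, b]` in which distinct paths with the same endpoints have
different passage times, so that all geodesics are unique. -/
structure IsRegular (a b : ℝ) (t : Edge d → ℝ) : Prop where
  le : ∀ e, a ≤ t e
  ge : ∀ e, t e ≤ b
  ne : ∀ (x y : Fin d → ℤ) (p q : (lattice d).Walk x y), p.IsPath → q.IsPath → p ≠ q →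
    passageTime t p ≠ passageTime t q

theorem IsRegular.exists_isUniqueGeodesic {a b : ℝ} (ha : 0 < a) {t : Edge d → ℝ}
    (ht : IsRegular a b t) (x y : Fin d → ℤ) :
    ∃ p : (lattice d).Walk x y, IsUniqueGeodesic t p ∧ p.IsPath := by
  obtain ⟨p, hp⟩ := exists_isGeodesic ha ht.le x y
  refine ⟨p, ⟨hp, fun q hq => ?_⟩, hp.isPath ha ht.le⟩
  by_contra hne
  exact ht.ne x y q p (hq.isPath ha ht.le) (hp.isPath ha ht.le) hne (le_antisymm (hq p) (hp q))

open Classical in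
theorem IsUniqueGeodesic.geodesicCount_eq {t : Edge d → ℝ} {x y : Fin d → ℤ}
    {p : (lattice d).Walk x y} (hp : IsUniqueGeodesic t p) (hpath : p.IsPath)
    (S : Set (Fin d → ℤ)) : geodesicCount S x y t = p.support.countP (· ∈ S) := by
  rw [geodesicCount, hp.geodesicVertices_eq, ncard_setOf_mem_inter hpath.support_nodup]

theorem geodesicCount_le {a b : ℝ} (ha : 0 < a) {t : Edge d → ℝ}
    (ht : IsRegular a b t) (S : Set (Fin d → ℤ)) (x y : Fin d → ℤ) :
    (geodesicCount S x y t : ℝ) ≤ b / a * l1Norm (x - y) + 1 := by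
  obtain ⟨p, hp, hpath⟩ := ht.exists_isUniqueGeodesic ha x y
  have hcount : (geodesicCount S x y t : ℝ) ≤ p.length + 1 := by
    rw [hp.geodesicCount_eq hpath]
    exact_mod_cast p.length_support ▸ List.countP_le_length
  have hlen : (p.length : ℝ) ≤ b / a * l1Norm (x - y) := by
    rw [div_mul_eq_mul_div, le_div_iff₀' ha]
    exact (mul_length_le_passageTime ht.le p).trans (hp.1.passageTime_le ht.ge)
  linarith

end FixedEnvironment

/-! ### Comparison of two environments -/

section Comparison

variable {d : ℕ} {a b : ℝ} {S : Set (Fin d → ℤ)} {A : Set ℝ}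

open Classical in
theorem countP_support_le_of_countP_take_lt (ha : 0 < a) {t : Edge d → ℝ} (hta : ∀ e, a ≤ t e)
    (htb : ∀ e, t e ≤ b) {x y : Fin d → ℤ} {K k : ℕ}
    (hS : ∀ u ∈ S, b * l1Norm (x - u) < a * K) {p : (lattice d).Walk x y} (hp : IsGeodesic t p)
    (hfew : (edgeList (p.take K)).countP (t · ∉ A) < k) :
    p.support.countP (· ∈ S) ≤
      (edgeList p).countP (fun e => e ∈ touching (lattice d) S ∧ t e ∈ A) + k := by
  -- By its `K`-th step the geodesic has left `S` for good.
  have hdrop : ∀ e ∈ edgeList (p.drop K), e ∉ touching (lattice d) S := by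
    rintro e he ⟨u, huS, hue⟩
    obtain ⟨n, rfl, hn⟩ := SimpleGraph.Walk.mem_support_iff_exists_getVert.1
      ((p.drop K).mem_support_of_mem_edges (mem_edgeList.1 he) hue)
    have hpos : 0 < (edgeList (p.drop K)).length := List.length_pos_of_mem he
    rw [length_edgeList, SimpleGraph.Walk.drop_length] at hpos
    rw [SimpleGraph.Walk.drop_length] at hn
    rw [SimpleGraph.Walk.drop_getVert] at huS
    have hvert := hp.mul_le_of_getVert hta htb (show K + n ≤ p.length by lia)
    have hmono : a * K ≤ a * ((K + n : ℕ) : ℝ) := by gcongr; lia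
    linarith [hS _ huS]
  have hbad : (edgeList p).countP (fun e => e ∈ touching (lattice d) S ∧ t e ∉ A) < k := by
    rw [← List.take_append_drop K (edgeList p), List.countP_append, ← edgeList_take,
      ← edgeList_drop, List.countP_eq_zero (l := edgeList (p.drop K)) |>.2 fun e he => by
        simp [hdrop e he], add_zero]
    refine (List.countP_mono_left fun e _ he => ?_).trans_lt hfew
    simpa using (of_decide_eq_true he).2
  have hsplit : (edgeList p).countP (· ∈ touching (lattice d) S) =
      (edgeList p).countP (fun e => e ∈ touching (lattice d) S ∧ t e ∈ A) +
        (edgeList p).countP (fun e => e ∈ touching (lattice d) S ∧ t e ∉ A) := by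
    rw [List.countP_eq_countP_filter_add _ _ (t · ∈ A), List.countP_filter, List.countP_filter]
    simp
  have := countP_support_le p S
  lia

section Gain

variable {t x : Edge d → ℝ} {y z : Fin d → ℤ} {κ η : ℝ}

theorem mul_countP_le_passageTime_sub (htx : ∀ e, t e ≤ x e) {q : Edge d → Prop}
    [DecidablePred q] (hlow : ∀ e, q e → κ ≤ x e - t e) (p : (lattice d).Walk y z) :
    κ * (edgeList p).countP q ≤ passageTime x p - passageTime t p := by
  simp only [passageTime_eq_sum_edgeList]
  induction edgeList p with
  | nil => simp
  | cons e l ih =>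
    simp only [List.map_cons, List.sum_cons, List.countP_cons, decide_eq_true_eq]
    split_ifs with he <;> push_cast
    · linarith [hlow e he]
    · linarith [htx e]

theorem passageTime_sub_le_mul_countP {q : Edge d → Prop} [DecidablePred q]
    (hup : ∀ e, q e → x e - t e ≤ η)
    (hoff : ∀ e, ¬ q e → x e = t e) (p : (lattice d).Walk y z) :
    passageTime x p - passageTime t p ≤ η * (edgeList p).countP q := by
  simp only [passageTime_eq_sum_edgeList]
  induction edgeList p with
  | nil => simp
  | cons e l ih =>
    simp only [List.map_cons, List.sum_cons, List.countP_cons, decide_eq_true_eq]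
    split_ifs with he <;> push_cast
    · linarith [hup e he]
    · linarith [hoff e he]

end Gain

open Classical in
/-- In the environment `t`, every path from the origin of length at most `K` has fewer than `k`
edges whose weight is not in `A`. -/
def FewOutside (A : Set ℝ) (K k : ℕ) (t : Edge d → ℝ) : Prop :=
  ∀ ⦃y : Fin d → ℤ⦄ (p : (lattice d).Walk 0 y), p.IsPath → p.length ≤ K →
    (edgeList p).countP (t · ∉ A) < k

open Classical in
/-- Lowering the weights near `S` by at least `κ` where `x e ∈ A` and by at most `η` elsewhere
favours the geodesic from `0` to `v`, which visits `S` often, over the one from `w` to `v + w`,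
which does not; each of them being optimal in its own environment, the advantage is at most the
cost of the detours between their endpoints. -/
theorem mul_geodesicCount_sub_le {κ η : ℝ} (ha : 0 < a) (hκ : 0 ≤ κ) (hη : 0 ≤ η)
    {t x : Edge d → ℝ} (ht : IsRegular a b t) (hx : IsRegular a b x) {K k : ℕ}
    (hS : ∀ u ∈ S, b * l1Norm u < a * K)
    (hfew : FewOutside A K k x)
    (htx : ∀ e, t e ≤ x e) (hlow : ∀ e ∈ touching (lattice d) S, x e ∈ A → κ ≤ x e - t e)
    (hup : ∀ e ∈ touching (lattice d) S, x e - t e ≤ η)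
    (hoff : ∀ e ∉ touching (lattice d) S, x e = t e) (v w : Fin d → ℤ) :
    κ * (geodesicCount S 0 v x - k) ≤
      η * (2 * geodesicCount S w (v + w) t) + 4 * b * l1Norm w := by
  obtain ⟨p, hp, hppath⟩ := hx.exists_isUniqueGeodesic ha 0 v
  obtain ⟨q, hq, hqpath⟩ := ht.exists_isUniqueGeodesic ha w (v + w)
  have hcount : (geodesicCount S 0 v x : ℝ) - k ≤
      (edgeList p).countP (fun e => e ∈ touching (lattice d) S ∧ x e ∈ A) := by
    rw [hp.geodesicCount_eq hppath, sub_le_iff_le_add]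
    exact_mod_cast countP_support_le_of_countP_take_lt ha hx.le hx.ge (by simpa using hS) hp.1
      (hfew _ (hppath.take K) (by simp))
  have hgain := mul_countP_le_passageTime_sub htx
    (q := fun e => e ∈ touching (lattice d) S ∧ x e ∈ A) (fun e he => hlow e he.1 he.2) p
  have hloss := passageTime_sub_le_mul_countP hup hoff q
  have htouch : ((edgeList q).countP (· ∈ touching (lattice d) S) : ℝ) ≤
      2 * geodesicCount S w (v + w) t := by
    rw [hq.geodesicCount_eq hqpath]
    exact_mod_cast countP_touching_le q S
  have hpq := hp.1.passageTime_le_add hx.ge q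
  have hqp := hq.1.passageTime_le_add ht.ge p
  simp only [zero_sub, sub_zero, add_sub_cancel_left, sub_add_cancel_left, l1Norm_neg] at hpq hqp
  have := mul_le_mul_of_nonneg_left hcount hκ
  have := mul_le_mul_of_nonneg_left htouch hη
  linarith

end Comparison

/-! ### Tilting a weight distribution -/

theorem measure_Ioc_eq_ofReal_cdf_sub (G : Measure ℝ) [IsProbabilityMeasure G] (x y : ℝ) :
    G (Set.Ioc x y) = ENNReal.ofReal (cdf G y - cdf G x) := by
  conv_lhs => rw [← measure_cdf G]
  exact StieltjesFunction.measure_Ioc _ _ _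

theorem continuous_cdf (G : Measure ℝ) [IsProbabilityMeasure G] [NullSingletonClass G] :
    Continuous (cdf G) := by
  refine continuous_iff_continuousAt.2 fun x => ?_
  have hx : G {x} = 0 := measure_singleton x
  rw [← measure_cdf G, StieltjesFunction.measure_singleton, ENNReal.ofReal_eq_zero,
    sub_nonpos] at hx
  rw [(monotone_cdf G).continuousAt_iff_leftLim_eq_rightLim, StieltjesFunction.rightLim_eq]
  exact ((monotone_cdf G).leftLim_le le_rfl).antisymm hx

/-- `G` lives on `[a, b]`, has no atoms and puts mass at least `α` times the length on each
subinterval: the consequences of `WeightAssumption` which the argument relies on. -/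
structure WeightBounds (G : Measure ℝ) (a b α : ℝ) : Prop where
  left_pos : 0 < a
  left_lt_right : a < b
  rate_pos : 0 < α
  measure_compl_Icc : G (Set.Icc a b)ᶜ = 0
  absolutelyContinuous : G ≪ volume
  le_measure_Ioc : ∀ x y, a ≤ x → y ≤ b → ENNReal.ofReal (α * (y - x)) ≤ G (Set.Ioc x y)

theorem WeightAssumption.exists_weightBounds {G : Measure ℝ} (hG : WeightAssumption G) :
    ∃ a b α, WeightBounds G a b α := by
  obtain ⟨a, b, α, ha, hab, hα, hsupp, ρ, -, rfl, hle⟩ := hG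
  refine ⟨a, b, α, ha, hab, hα, hsupp, withDensity_absolutelyContinuous _ _, fun x y hx hy => ?_⟩
  rw [withDensity_apply _ measurableSet_Ioc]
  have hsub : Set.Ioc x y ⊆ Set.Icc a b := fun z hz => ⟨hx.trans hz.1.le, hz.2.trans hy⟩
  calc ENNReal.ofReal (α * (y - x)) = ∫⁻ _ in Set.Ioc x y, ENNReal.ofReal α := by
        rw [setLIntegral_const, Real.volume_Ioc, ENNReal.ofReal_mul hα.le]
    _ ≤ ∫⁻ z in Set.Ioc x y, ρ z :=
        lintegral_mono_ae (ae_restrict_of_ae_restrict_of_subset hsub hle)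

namespace WeightBounds

variable {G : Measure ℝ} {a b α : ℝ}

theorem nullSingletonClass (hG : WeightBounds G a b α) : NullSingletonClass G :=
  ⟨fun x => hG.absolutelyContinuous (measure_singleton x)⟩

variable [IsProbabilityMeasure G]

theorem cdf_left (hG : WeightBounds G a b α) : cdf G a = 0 := by
  have := hG.nullSingletonClass
  rw [cdf_eq_real, ← measureReal_congr Iio_ae_eq_Iic, measureReal_def,
    measure_mono_null (fun x hx h => not_lt.2 h.1 hx : Set.Iio a ⊆ (Set.Icc a b)ᶜ)
      hG.measure_compl_Icc, ENNReal.toReal_zero]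

theorem cdf_right (hG : WeightBounds G a b α) : cdf G b = 1 := by
  rw [cdf_eq_real, measureReal_def, (prob_compl_eq_zero_iff measurableSet_Iic).1,
    ENNReal.toReal_one]
  exact measure_mono_null (Set.compl_subset_compl.2 fun x hx => hx.2) hG.measure_compl_Icc

theorem mul_sub_le_cdf_sub (hG : WeightBounds G a b α) {x y : ℝ} (hx : a ≤ x) (hxy : x ≤ y)
    (hy : y ≤ b) : α * (y - x) ≤ cdf G y - cdf G x := by
  have h := hG.le_measure_Ioc x y hx hy
  rwa [measure_Ioc_eq_ofReal_cdf_sub,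
    ENNReal.ofReal_le_ofReal_iff (sub_nonneg.2 (monotone_cdf G hxy))] at h

theorem strictMonoOn_cdf (hG : WeightBounds G a b α) : StrictMonoOn (cdf G) (Set.Icc a b) :=
  fun x hx y hy hxy => by
    have := hG.mul_sub_le_cdf_sub hx.1 hxy.le hy.2
    linarith [mul_pos hG.rate_pos (sub_pos.2 hxy)]

theorem cdf_le_cdf_iff (hG : WeightBounds G a b α) {x y : ℝ} (hy : y ∈ Set.Ico a b) :
    cdf G x ≤ cdf G y ↔ x ≤ y := by
  refine ⟨fun h => ?_, fun h => monotone_cdf G h⟩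
  by_contra! hyx
  have hlt : cdf G y < cdf G (min x b) := hG.strictMonoOn_cdf (Set.Ico_subset_Icc_self hy)
    ⟨hy.1.trans (le_min hyx.le hy.2.le), min_le_right x b⟩ (lt_min hyx hy.2)
  exact absurd (hlt.trans_le (monotone_cdf G (min_le_left x b))) (not_lt.2 h)

theorem exists_cdf_eq (hG : WeightBounds G a b α) {s : ℝ} (hs : s ∈ Set.Icc (0 : ℝ) 1) :
    ∃ y ∈ Set.Icc a b, cdf G y = s := by
  have := hG.nullSingletonClass
  have h := intermediate_value_Icc hG.left_lt_right.le (continuous_cdf G).continuousOn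
  rw [hG.cdf_left, hG.cdf_right] at h
  exact h hs

theorem exists_cdf_eq_of_lt_one (hG : WeightBounds G a b α) {s : ℝ} (h0 : 0 ≤ s) (h1 : s < 1) :
    ∃ y ∈ Set.Ico a b, cdf G y = s := by
  obtain ⟨y, hy, rfl⟩ := hG.exists_cdf_eq ⟨h0, h1.le⟩
  refine ⟨y, ⟨hy.1, hy.2.lt_of_ne fun h => ?_⟩, rfl⟩
  rw [h, hG.cdf_right] at h1
  exact h1.false

end WeightBounds

/-- The distribution function, in terms of the original one, of a measure whose density has been
multiplied by `1 - τ` below the median and by `1 + τ` above it. -/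
noncomputable def tilt (τ s : ℝ) : ℝ := s - τ * min s (1 - s)

theorem continuous_tilt (τ : ℝ) : Continuous (tilt τ) := by
  unfold tilt
  fun_prop

theorem tilt_zero (τ : ℝ) : tilt τ 0 = 0 := by simp [tilt]

theorem tilt_one (τ : ℝ) : tilt τ 1 = 1 := by simp [tilt]

theorem strictMono_tilt {τ : ℝ} (h0 : 0 ≤ τ) (h1 : τ < 1) : StrictMono (tilt τ) := by
  intro s s' h
  unfold tilt
  rcases min_cases s (1 - s) with ⟨e, _⟩ | ⟨e, _⟩ <;>
  rcases min_cases s' (1 - s') with ⟨e', _⟩ | ⟨e', _⟩ <;> rw [e, e'] <;> nlinarith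

theorem tilt_mem_Icc {τ s : ℝ} (h0 : 0 ≤ τ) (h1 : τ < 1) (hs : s ∈ Set.Icc (0 : ℝ) 1) :
    tilt τ s ∈ Set.Icc (0 : ℝ) 1 := by
  have hmono := (strictMono_tilt h0 h1).monotone
  exact ⟨tilt_zero τ ▸ hmono hs.1, (hmono hs.2).trans_eq (tilt_one τ)⟩

theorem exists_tilt_eq (τ : ℝ) {s : ℝ} (hs0 : 0 ≤ s) (hs1 : s < 1) :
    ∃ s' ∈ Set.Ico (0 : ℝ) 1, tilt τ s' = s := by
  have h := intermediate_value_Ico zero_le_one (continuous_tilt τ).continuousOn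
  rw [tilt_zero, tilt_one] at h
  exact h ⟨hs0, hs1⟩

/-- The density with respect to `G` which is `1 - τ` below the median and `1 + τ` above it. -/
noncomputable def tiltDensity (G : Measure ℝ) (τ x : ℝ) : ENNReal :=
  if cdf G x ≤ 1 / 2 then ENNReal.ofReal (1 - τ) else ENNReal.ofReal (1 + τ)

theorem measurable_tiltDensity (G : Measure ℝ) (τ : ℝ) : Measurable (tiltDensity G τ) :=
  Measurable.ite (measurableSet_le (monotone_cdf G).measurable measurable_const)
    measurable_const measurable_const

section TiltDensity

variable {G : Measure ℝ} [IsProbabilityMeasure G] {a b α τ : ℝ}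

theorem WeightBounds.setLIntegral_comp_tiltDensity (hG : WeightBounds G a b α)
    (f : ENNReal → ENNReal) {s : Set ℝ} (hs : MeasurableSet s) :
    ∃ m ∈ Set.Ico a b, cdf G m = 1 / 2 ∧ ∫⁻ x in s, f (tiltDensity G τ x) ∂G =
      f (ENNReal.ofReal (1 - τ)) * G (Set.Iic m ∩ s) +
        f (ENNReal.ofReal (1 + τ)) * G (Set.Ioi m ∩ s) := by
  obtain ⟨m, hm, hmF⟩ := hG.exists_cdf_eq_of_lt_one (s := 1 / 2) (by norm_num) (by norm_num)
  have hmem : ∀ x, cdf G x ≤ 1 / 2 ↔ x ∈ Set.Iic m := fun x => hmF ▸ hG.cdf_le_cdf_iff hm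
  refine ⟨m, hm, hmF, ?_⟩
  rw [← lintegral_add_compl _ (measurableSet_Iic (a := m)), Set.compl_Iic,
    Measure.restrict_restrict measurableSet_Iic, Measure.restrict_restrict measurableSet_Ioi,
    setLIntegral_congr_fun (g := fun _ => f (ENNReal.ofReal (1 - τ)))
      (measurableSet_Iic.inter hs) fun x hx => by
        simp only [tiltDensity, if_pos ((hmem x).2 hx.1)],
    setLIntegral_congr_fun (g := fun _ => f (ENNReal.ofReal (1 + τ)))
      (measurableSet_Ioi.inter hs) fun x hx => by
        simp only [tiltDensity, if_neg (mt (hmem x).1 (Set.notMem_Iic.2 hx.1))],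
    setLIntegral_const, setLIntegral_const]

theorem WeightBounds.lintegral_tiltDensity_pow (hG : WeightBounds G a b α) (h0 : 0 ≤ τ)
    (h1 : τ < 1) (n : ℕ) :
    ∫⁻ x, tiltDensity G τ x ^ n ∂G = ENNReal.ofReal (((1 - τ) ^ n + (1 + τ) ^ n) / 2) := by
  obtain ⟨m, -, hmF, hint⟩ :=
    hG.setLIntegral_comp_tiltDensity (τ := τ) (· ^ n) MeasurableSet.univ
  have hIic : G (Set.Iic m) = ENNReal.ofReal (1 / 2) := by rw [← ofReal_cdf, hmF]
  have hIoi : G (Set.Ioi m) = ENNReal.ofReal (1 / 2) := by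
    rw [← Set.compl_Iic, prob_compl_eq_one_sub measurableSet_Iic, hIic, ← ENNReal.ofReal_one,
      ← ENNReal.ofReal_sub _ (by norm_num)]
    norm_num
  have := sub_pos.2 h1
  rw [Measure.restrict_univ, Set.inter_univ, Set.inter_univ, hIic, hIoi] at hint
  rw [hint, ← ENNReal.ofReal_pow (by positivity), ← ENNReal.ofReal_pow (by positivity),
    ← ENNReal.ofReal_mul (by positivity), ← ENNReal.ofReal_mul (by positivity),
    ← ENNReal.ofReal_add (by positivity) (by positivity)]
  congr 1
  ring

theorem WeightBounds.withDensity_tiltDensity_Iic (hG : WeightBounds G a b α) (h0 : 0 ≤ τ)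
    (h1 : τ < 1) (z : ℝ) :
    G.withDensity (tiltDensity G τ) (Set.Iic z) = ENNReal.ofReal (tilt τ (cdf G z)) := by
  obtain ⟨m, -, hmF, hint⟩ :=
    hG.setLIntegral_comp_tiltDensity (τ := τ) id (measurableSet_Iic (a := z))
  have := sub_pos.2 h1
  simp only [id] at hint
  rw [withDensity_apply _ measurableSet_Iic, hint, Set.Iic_inter_Iic, Set.Ioi_inter_Iic,
    measure_Ioc_eq_ofReal_cdf_sub, ← ofReal_cdf G (m ⊓ z), hmF,
    ← ENNReal.ofReal_mul (by positivity), ← ENNReal.ofReal_mul (by positivity)]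
  rcases le_total z m with hz | hz <;> have hzF := monotone_cdf G hz <;> rw [hmF] at hzF
  · rw [inf_eq_right.2 hz, ENNReal.ofReal_of_nonpos (p := (1 + τ) * _) (by nlinarith), add_zero,
      tilt, min_eq_left (by linarith)]
    ring_nf
  · rw [inf_eq_left.2 hz, hmF, ← ENNReal.ofReal_add (by positivity) (by nlinarith), tilt,
      min_eq_right (by linarith)]
    ring_nf

theorem WeightBounds.isProbabilityMeasure_withDensity_tiltDensity (hG : WeightBounds G a b α)
    (h0 : 0 ≤ τ) (h1 : τ < 1) : IsProbabilityMeasure (G.withDensity (tiltDensity G τ)) := by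
  have h := hG.lintegral_tiltDensity_pow h0 h1 1
  refine ⟨?_⟩
  rw [withDensity_apply _ .univ, Measure.restrict_univ]
  simpa using h

end TiltDensity

/-- The map `φ` transports the tilted measure back to `G`. -/
structure IsUntilting (G : Measure ℝ) (a b τ : ℝ) (φ : ℝ → ℝ) : Prop where
  measurable : Measurable φ
  map_eq : (G.withDensity (tiltDensity G τ)).map φ = G
  mem_Icc : ∀ x, φ x ∈ Set.Icc a b
  cdf_eq : ∀ x, cdf G (φ x) = tilt τ (cdf G x)

namespace WeightBounds

variable {G : Measure ℝ} [IsProbabilityMeasure G] {a b α τ : ℝ}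

theorem map_eq_of_cdf_comp_eq_tilt (hG : WeightBounds G a b α) (h0 : 0 ≤ τ) (h1 : τ < 1)
    {φ : ℝ → ℝ} (hφ : Measurable φ) (hmem : ∀ x, φ x ∈ Set.Icc a b)
    (hcdf : ∀ x, cdf G (φ x) = tilt τ (cdf G x)) :
    (G.withDensity (tiltDensity G τ)).map φ = G := by
  have := hG.isProbabilityMeasure_withDensity_tiltDensity h0 h1
  refine Measure.ext_of_Iic _ _ fun y => ?_
  rw [Measure.map_apply hφ measurableSet_Iic, ← ofReal_cdf]
  rcases lt_or_ge y a with hya | hya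
  · have hempty : φ ⁻¹' Set.Iic y = ∅ :=
      Set.eq_empty_of_forall_notMem fun x hx => absurd (hya.trans_le (hmem x).1) (not_lt.2 hx)
    rw [hempty, measure_empty, ENNReal.ofReal_of_nonpos]
    exact hG.cdf_left ▸ monotone_cdf G hya.le
  rcases le_or_gt b y with hby | hyb
  · have huniv : φ ⁻¹' Set.Iic y = Set.univ := Set.eq_univ_of_forall fun x => (hmem x).2.trans hby
    rw [huniv, measure_univ, eq_comm, ENNReal.ofReal_eq_one]
    exact (cdf_le_one G y).antisymm (hG.cdf_right ▸ monotone_cdf G hby)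
  · have hy1 : cdf G y < 1 :=
      hG.cdf_right ▸ hG.strictMonoOn_cdf ⟨hya, hyb.le⟩ ⟨hya.trans hyb.le, le_rfl⟩ hyb
    obtain ⟨s, hs, hsy⟩ := exists_tilt_eq τ (cdf_nonneg G y) hy1
    obtain ⟨z, hz, rfl⟩ := hG.exists_cdf_eq_of_lt_one hs.1 hs.2
    have hIic : φ ⁻¹' Set.Iic y = Set.Iic z := Set.ext fun x => by
      rw [Set.mem_preimage, Set.mem_Iic, Set.mem_Iic, ← hG.cdf_le_cdf_iff ⟨hya, hyb⟩, hcdf, ← hsy,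
        (strictMono_tilt h0 h1).le_iff_le, hG.cdf_le_cdf_iff hz]
    rw [hIic, hG.withDensity_tiltDensity_Iic h0 h1, hsy]

theorem exists_isUntilting (hG : WeightBounds G a b α) (h0 : 0 ≤ τ) (h1 : τ < 1) :
    ∃ φ, IsUntilting G a b τ φ := by
  choose φ hmem hcdf using fun x => hG.exists_cdf_eq
    (tilt_mem_Icc h0 h1 ⟨cdf_nonneg G x, cdf_le_one G x⟩)
  have hmono : Monotone φ := fun x y hxy => by
    rw [← hG.strictMonoOn_cdf.le_iff_le (hmem x) (hmem y), hcdf, hcdf,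
      (strictMono_tilt h0 h1).le_iff_le]
    exact monotone_cdf G hxy
  exact ⟨φ, hmono.measurable,
    hG.map_eq_of_cdf_comp_eq_tilt h0 h1 hmono.measurable hmem hcdf, hmem, hcdf⟩

end WeightBounds

namespace IsUntilting

variable {G : Measure ℝ} [IsProbabilityMeasure G] {a b α τ x : ℝ} {φ : ℝ → ℝ}

theorem map_le (h : IsUntilting G a b τ φ) (hG : WeightBounds G a b α) (h0 : 0 ≤ τ)
    (hx : x ∈ Set.Icc a b) : φ x ≤ x := by
  have := le_min (cdf_nonneg G x) (sub_nonneg.2 (cdf_le_one G x))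
  rw [← hG.strictMonoOn_cdf.le_iff_le (h.mem_Icc x) hx, h.cdf_eq, tilt]
  nlinarith

theorem sub_map_le (h : IsUntilting G a b τ φ) (hG : WeightBounds G a b α) (h0 : 0 ≤ τ)
    (hx : x ∈ Set.Icc a b) : x - φ x ≤ τ / α := by
  have hα := hG.mul_sub_le_cdf_sub (h.mem_Icc x).1 (h.map_le hG h0 hx) hx.2
  have hmin : min (cdf G x) (1 - cdf G x) ≤ 1 := (min_le_left _ _).trans (cdf_le_one G x)
  rw [h.cdf_eq, tilt] at hα
  rw [le_div_iff₀ hG.rate_pos]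
  nlinarith

end IsUntilting

/-- The weights around which `G` is not too concentrated, and which are not too extreme, in a
quantitative form: undoing a tilt of size `τ` lowers them by at least `τ / C ^ 2`. -/
def tameWeights (G : Measure ℝ) (C : ℝ) : Set ℝ :=
  {x | (∀ h, 0 ≤ h → cdf G x - cdf G (x - h) ≤ C * h) ∧ 1 ≤ C * min (cdf G x) (1 - cdf G x)}

section TameWeights

variable {G : Measure ℝ} {a b α C x : ℝ}

theorem monotone_tameWeights : Monotone (tameWeights G) := fun C C' hC x hx =>
  ⟨fun h hh => (hx.1 h hh).trans (by gcongr),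
    hx.2.trans (mul_le_mul_of_nonneg_right hC
      (le_min (cdf_nonneg G x) (sub_nonneg.2 (cdf_le_one G x))))⟩

theorem exists_forall_cdf_sub_le_of_differentiableAt (hd : DifferentiableAt ℝ (cdf G) x) :
    ∃ C, ∀ h, 0 ≤ h → cdf G x - cdf G (x - h) ≤ C * h := by
  obtain ⟨C, hC⟩ := hd.isBigO_sub.bound
  obtain ⟨ε, hε, hball⟩ := Metric.eventually_nhds_iff.1 hC
  refine ⟨max C (1 / ε), fun h hh => ?_⟩
  rcases lt_or_ge h ε with hlt | hge
  · have hnear := hball (y := x - h) (by simpa [abs_of_nonneg hh] using hlt)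
    rw [sub_sub_cancel_left, norm_neg, Real.norm_eq_abs, Real.norm_eq_abs, abs_of_nonneg hh,
      abs_sub_comm] at hnear
    exact (le_abs_self _).trans (hnear.trans (by gcongr; exact le_max_left _ _))
  · calc cdf G x - cdf G (x - h) ≤ 1 := by linarith [cdf_le_one G x, cdf_nonneg G (x - h)]
      _ ≤ 1 / ε * h := by rwa [one_div_mul_eq_div, one_le_div hε]
      _ ≤ max C (1 / ε) * h := by gcongr; exact le_max_right _ _

variable [IsProbabilityMeasure G]

theorem measurableSet_tameWeights [NullSingletonClass G] : MeasurableSet (tameWeights G C) := by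
  have hc := continuous_cdf G
  have heq : tameWeights G C =
      (⋂ h : ℝ, ⋂ _ : 0 ≤ h, {x | cdf G x - cdf G (x - h) ≤ C * h}) ∩
        {x | 1 ≤ C * min (cdf G x) (1 - cdf G x)} := by
    ext; simp [tameWeights]
  rw [heq]
  refine (IsClosed.inter (isClosed_iInter fun h => isClosed_iInter fun _ => ?_) ?_).measurableSet
  · exact isClosed_le (by fun_prop) (by fun_prop)
  · exact isClosed_le (by fun_prop) (by fun_prop)

theorem IsUntilting.div_sq_le_sub_map {τ : ℝ} {φ : ℝ → ℝ} (h : IsUntilting G a b τ φ)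
    (hG : WeightBounds G a b α) (h0 : 0 ≤ τ) (hC : 0 < C) (hx : x ∈ Set.Icc a b)
    (htame : x ∈ tameWeights G C) : τ / C ^ 2 ≤ x - φ x := by
  have hlip := htame.1 (x - φ x) (sub_nonneg.2 (h.map_le hG h0 hx))
  rw [sub_sub_cancel, h.cdf_eq, tilt, sub_sub_cancel] at hlip
  rw [div_le_iff₀ (by positivity)]
  calc τ = τ * 1 := (mul_one τ).symm
    _ ≤ τ * (C * min (cdf G x) (1 - cdf G x)) := by gcongr; exact htame.2
    _ = C * (τ * min (cdf G x) (1 - cdf G x)) := by ring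
    _ ≤ C * (C * (x - φ x)) := by gcongr
    _ = (x - φ x) * C ^ 2 := by ring

theorem WeightBounds.ae_exists_mem_tameWeights (hG : WeightBounds G a b α) :
    ∀ᵐ x ∂G, ∃ n : ℕ, x ∈ tameWeights G n := by
  have := hG.nullSingletonClass
  have hdiff : ∀ᵐ x ∂G, DifferentiableAt ℝ (cdf G) x :=
    hG.absolutelyContinuous.ae_le (monotone_cdf G).ae_differentiableAt
  have hmem : ∀ᵐ x ∂G, x ∈ Set.Ioo a b := by
    filter_upwards [(Ioo_ae_eq_Icc (μ := G) (a := a) (b := b)).mem_iff,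
      mem_ae_iff.2 hG.measure_compl_Icc] with x hiff hx using hiff.2 hx
  filter_upwards [hdiff, hmem] with x hd hx
  obtain ⟨C, hC⟩ := exists_forall_cdf_sub_le_of_differentiableAt hd
  have hab := hG.left_lt_right.le
  have hmin : 0 < min (cdf G x) (1 - cdf G x) := by
    refine lt_min ?_ (sub_pos.2 ?_)
    · exact hG.cdf_left ▸ hG.strictMonoOn_cdf ⟨le_rfl, hab⟩ (Set.Ioo_subset_Icc_self hx) hx.1
    · exact hG.cdf_right ▸ hG.strictMonoOn_cdf (Set.Ioo_subset_Icc_self hx) ⟨hab, le_rfl⟩ hx.2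
  obtain ⟨n, hn⟩ := exists_nat_ge (max C (1 / min (cdf G x) (1 - cdf G x)))
  obtain ⟨hnC, hnmin⟩ := max_le_iff.1 hn
  exact ⟨n, fun h hh => (hC h hh).trans (by gcongr), (div_le_iff₀ hmin).1 hnmin⟩

theorem WeightBounds.exists_measure_compl_tameWeights_lt (hG : WeightBounds G a b α)
    {p : ENNReal} (hp : 0 < p) : ∃ C, 0 < C ∧ G (tameWeights G C)ᶜ < p := by
  have := hG.nullSingletonClass
  have hanti : Antitone fun n : ℕ => (tameWeights G n)ᶜ := fun m n hmn =>
    Set.compl_subset_compl.2 (monotone_tameWeights (Nat.cast_le.2 hmn))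
  have hnull : G (⋂ n : ℕ, (tameWeights G n)ᶜ) = 0 := by
    rw [← Set.compl_iUnion, measure_eq_zero_iff_ae_notMem]
    filter_upwards [hG.ae_exists_mem_tameWeights] with x hx
    simpa using hx
  have hlim := tendsto_measure_iInter_atTop (μ := G)
    (fun n => (measurableSet_tameWeights (G := G)).compl.nullMeasurableSet) hanti
    ⟨0, measure_ne_top _ _⟩
  rw [hnull] at hlim
  obtain ⟨n, hn, hpos⟩ :=
    ((hlim.eventually_lt_const hp).and (Filter.eventually_gt_atTop 0)).exists
  exact ⟨n, Nat.cast_pos.2 hpos, hn⟩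

end TameWeights

/-! ### Independent weights -/

section ProductMeasure

variable {ι : Type*} {X : ι → Type*} [∀ i, MeasurableSpace (X i)] (μ : ∀ i, Measure (X i))
  [∀ i, IsProbabilityMeasure (μ i)] {f : ∀ i, X i → ENNReal}

theorem lintegral_prod_infinitePi (hf : ∀ i, Measurable (f i)) (s : Finset ι) :
    ∫⁻ x, ∏ i ∈ s, f i (x i) ∂(Measure.infinitePi μ) = ∏ i ∈ s, ∫⁻ y, f i y ∂(μ i) := by
  have hmeas : ∀ i, Measurable fun x : ∀ i, X i => f i (x i) := fun i =>
    (hf i).comp (measurable_pi_apply i)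
  rw [lintegral_prod_eq_prod_lintegral_of_indepFun s _ (iIndepFun_infinitePi hf) hmeas]
  refine Finset.prod_congr rfl fun i _ => ?_
  rw [← Measure.infinitePi_map_eval μ i, lintegral_map (hf i) (measurable_pi_apply i)]

theorem infinitePi_withDensity [∀ i, IsProbabilityMeasure ((μ i).withDensity (f i))]
    (hf : ∀ i, Measurable (f i)) (R : Finset ι) (hR : ∀ i ∉ R, f i = 1) :
    Measure.infinitePi (fun i => (μ i).withDensity (f i)) =
      (Measure.infinitePi μ).withDensity fun x => ∏ i ∈ R, f i (x i) := by
  classical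
  refine (Measure.eq_infinitePi _ fun s u hu => ?_).symm
  let v : ∀ i, Set (X i) := fun i => if i ∈ s then u i else Set.univ
  have hv : ∀ i, MeasurableSet (v i) := fun i => by
    by_cases hi : i ∈ s <;> simp only [v, hi, if_true, if_false, hu i, MeasurableSet.univ]
  have hbox : MeasurableSet ((s : Set ι).pi u) := .pi s.countable_toSet fun i _ => hu i
  have hprod : ∀ x, ((s : Set ι).pi u).indicator (fun x => ∏ i ∈ R, f i (x i)) x =
      ∏ i ∈ s ∪ R, (v i).indicator (f i) (x i) := fun x => by
    by_cases hx : x ∈ (s : Set ι).pi u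
    · rw [Set.indicator_of_mem hx, ← Finset.prod_subset Finset.subset_union_right fun i _ hi => ?_]
      · refine Finset.prod_congr rfl fun i _ => (Set.indicator_of_mem ?_ _).symm
        by_cases hi : i ∈ s
        · simpa only [v, hi, if_true] using hx i hi
        · simp only [v, hi, if_false, Set.mem_univ]
      · by_cases his : i ∈ s
        · rw [Set.indicator_of_mem (by simpa only [v, his, if_true] using hx i his), hR i hi,
            Pi.one_apply]
        · simp only [v, his, if_false, Set.indicator_univ, hR i hi, Pi.one_apply]
    · obtain ⟨i, his, hi⟩ : ∃ i ∈ s, x i ∉ u i := by simpa [Set.mem_pi] using hx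
      rw [Set.indicator_of_notMem hx, Finset.prod_eq_zero (Finset.mem_union_left R his)]
      exact Set.indicator_of_notMem (by simpa only [v, his, if_true] using hi) _
  rw [withDensity_apply _ hbox, ← lintegral_indicator hbox, lintegral_congr hprod,
    lintegral_prod_infinitePi μ fun i => (hf i).indicator (hv i),
    ← Finset.prod_subset Finset.subset_union_left fun i _ hi => ?_]
  · refine Finset.prod_congr rfl fun i hi => ?_
    rw [lintegral_indicator (hv i), ← withDensity_apply _ (hv i)]
    simp only [v, hi, if_true]
  · rw [lintegral_indicator (hv i), ← withDensity_apply _ (hv i)]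
    simp only [v, hi, if_false, measure_univ]

end ProductMeasure

theorem measureReal_le_withDensity_add {Ω : Type*} [MeasurableSpace Ω] (μ : Measure Ω)
    [IsProbabilityMeasure μ] {Λ : Ω → ENNReal} (hΛ : Measurable Λ) (hΛ1 : ∫⁻ ω, Λ ω ∂μ = 1)
    {δ : NNReal} (hδ : 0 < δ) (hΛ2 : ∫⁻ ω, Λ ω ^ 2 ∂μ ≤ 1 + δ ^ 2) {B : Set Ω}
    (hB : MeasurableSet B) : μ.real B ≤ (μ.withDensity Λ).real B + δ := by
  have hpoint : ∀ ω, B.indicator (fun _ => 2 * (δ : ENNReal)) ω + 2 * Λ ω ≤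
      B.indicator (fun ω => 2 * δ * Λ ω) ω + (1 + Λ ω ^ 2 + δ ^ 2) := fun ω => by
    rcases eq_or_ne (Λ ω) ⊤ with htop | htop
    · simp [htop]
    lift Λ ω to NNReal using htop with z hz
    by_cases hω : ω ∈ B
    · have : 2 * δ + 2 * z ≤ 2 * δ * z + (1 + z ^ 2 + δ ^ 2) := by
        rw [← NNReal.coe_le_coe]
        push_cast
        nlinarith [sq_nonneg (1 - z - δ : ℝ)]
      rw [Set.indicator_of_mem hω, Set.indicator_of_mem hω, ← hz]
      exact_mod_cast this
    · have : 2 * z ≤ 1 + z ^ 2 + δ ^ 2 := by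
        rw [← NNReal.coe_le_coe]
        push_cast
        nlinarith [sq_nonneg (1 - z : ℝ), sq_nonneg (δ : ℝ)]
      rw [Set.indicator_of_notMem hω, Set.indicator_of_notMem hω, zero_add, zero_add]
      exact_mod_cast this
  have hint := lintegral_mono (μ := μ) hpoint
  have : IsProbabilityMeasure (μ.withDensity Λ) :=
    ⟨by rw [withDensity_apply _ .univ, Measure.restrict_univ, hΛ1]⟩
  rw [lintegral_add_left (measurable_const.indicator hB),
    lintegral_add_left ((hΛ.const_mul _).indicator hB), lintegral_indicator hB,
    lintegral_indicator hB, setLIntegral_const, lintegral_const_mul _ hΛ, lintegral_const_mul _ hΛ,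
    ← withDensity_apply _ hB, lintegral_add_right _ measurable_const,
    lintegral_add_left measurable_const, lintegral_const, lintegral_const, measure_univ, hΛ1,
    mul_one, mul_one, mul_one] at hint
  have hbound := hint.trans (show _ ≤ 2 * δ * (μ.withDensity Λ) B + (1 + (1 + δ ^ 2) + δ ^ 2) by
    gcongr)
  rw [measureReal_def, measureReal_def]
  lift μ B to NNReal using measure_ne_top μ B with x
  lift (μ.withDensity Λ) B to NNReal using measure_ne_top _ B with y
  have hreal : 2 * (δ : ℝ) * x + 2 ≤ 2 * δ * y + (1 + (1 + δ ^ 2) + δ ^ 2) := by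
    exact_mod_cast hbound
  rw [ENNReal.coe_toReal, ENNReal.coe_toReal]
  exact le_of_mul_le_mul_left (by linarith) (NNReal.coe_pos.2 hδ)

theorem ae_ne_of_indepFun {Ω : Type*} [MeasurableSpace Ω] {μ : Measure Ω}
    [IsProbabilityMeasure μ] {X Y : Ω → ℝ} (hX : Measurable X) (hY : Measurable Y)
    (hXY : X ⟂ᵢ[μ] Y) (hX0 : ∀ y, μ (X ⁻¹' {y}) = 0) : ∀ᵐ ω ∂μ, X ω ≠ Y ω := by
  have hdiag : MeasurableSet {z : ℝ × ℝ | z.1 = z.2} :=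
    measurableSet_eq_fun measurable_fst measurable_snd
  have hprob := Measure.isProbabilityMeasure_map (μ := μ) hY.aemeasurable
  have hpre : {ω | ¬X ω ≠ Y ω} = (fun ω => (X ω, Y ω)) ⁻¹' {z : ℝ × ℝ | z.1 = z.2} := by
    ext; simp
  rw [indepFun_iff_map_prod_eq_prod_map_map hX.aemeasurable hY.aemeasurable] at hXY
  rw [ae_iff, hpre, ← Measure.map_apply (hX.prodMk hY) hdiag, hXY, Measure.prod_apply_symm hdiag,
    lintegral_eq_zero_iff (measurable_measure_prodMk_right hdiag)]
  refine Filter.Eventually.of_forall fun y => ?_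
  have hslice : (fun x => (x, y)) ⁻¹' {z : ℝ × ℝ | z.1 = z.2} = {y} := by
    ext; simp
  beta_reduce
  rw [hslice, Measure.map_apply hX (measurableSet_singleton y), hX0, Pi.zero_apply]

/-- The law of independent weights with common law `G`. -/
noncomputable abbrev iidLaw (ι : Type*) (G : Measure ℝ) [IsProbabilityMeasure G] :
    Measure (ι → ℝ) :=
  Measure.infinitePi fun _ => G

section IIDLaw

variable {ι : Type*} {G : Measure ℝ} [IsProbabilityMeasure G]

theorem ae_forall_mem_iidLaw [Countable ι] {s : Set ℝ} (hs : ∀ᵐ x ∂G, x ∈ s) :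
    ∀ᵐ t ∂(iidLaw ι G), ∀ i, t i ∈ s :=
  ae_all_iff.2 fun i =>
    (measurePreserving_eval_infinitePi (fun _ : ι => G) i).quasiMeasurePreserving.ae hs

theorem ae_sum_mul_ne_zero [NullSingletonClass G] {s : Finset ι} {c : ι → ℝ} {i : ι} (hi : i ∈ s)
    (hc : c i ≠ 0) : ∀ᵐ t ∂(iidLaw ι G), ∑ j ∈ s, c j * t j ≠ 0 := by
  classical
  have hmeas : ∀ j, Measurable fun t : ι → ℝ => c j * t j := fun j => by fun_prop
  have hind : iIndepFun (fun j (t : ι → ℝ) => c j * t j) (iidLaw ι G) :=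
    iIndepFun_infinitePi (X := fun j x => c j * x) fun j => by fun_prop
  have hind' := (hind.indepFun_finsetSum_of_notMem hmeas (s.notMem_erase i)).symm
  have hatom : ∀ y, iidLaw ι G ((fun t => c i * t i) ⁻¹' {y}) = 0 := fun y => by
    have hpre : (fun t : ι → ℝ => c i * t i) ⁻¹' {y} =
        Function.eval i ⁻¹' ({y / c i} : Set ℝ) := by
      ext t
      simp [eq_div_iff hc, mul_comm]
    rw [hpre, (measurePreserving_eval_infinitePi (fun _ : ι => G) i).measure_preimage
      (measurableSet_singleton _).nullMeasurableSet, measure_singleton]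
  filter_upwards [ae_ne_of_indepFun (hmeas i) (by fun_prop)
    (hind'.comp measurable_id measurable_neg) hatom] with t ht hzero
  rw [← Finset.add_sum_erase s _ hi] at hzero
  exact ht (by simpa using eq_neg_of_add_eq_zero_left hzero)

theorem ae_sum_map_ne_of_not_perm [NullSingletonClass G] {l l' : List ι} (h : ¬l.Perm l') :
    ∀ᵐ t ∂(iidLaw ι G), (l.map t).sum ≠ (l'.map t).sum := by
  classical
  obtain ⟨i, hi⟩ : ∃ i, l.count i ≠ l'.count i := by simpa [List.perm_iff_count] using h
  have hsum : ∀ (t : ι → ℝ) {l₀ : List ι}, l₀ ⊆ l ++ l' →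
      (l₀.map t).sum = ∑ j ∈ (l ++ l').toFinset, (l₀.count j : ℝ) * t j := fun t l₀ hsub => by
    simp only [Finset.sum_list_map_count, nsmul_eq_mul]
    refine Finset.sum_subset (fun j hj => ?_) fun j _ hj => ?_
    · exact List.mem_toFinset.2 (hsub (List.mem_toFinset.1 hj))
    · rw [List.count_eq_zero_of_not_mem (mt List.mem_toFinset.2 hj), Nat.cast_zero, zero_mul]
  have hmem : i ∈ (l ++ l').toFinset := by
    by_contra hi'
    rw [List.mem_toFinset, List.mem_append, not_or] at hi'
    exact hi ((List.count_eq_zero_of_not_mem hi'.1).trans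
      (List.count_eq_zero_of_not_mem hi'.2).symm)
  filter_upwards [ae_sum_mul_ne_zero (G := G) (c := fun j => (l.count j : ℝ) - l'.count j) hmem
    (sub_ne_zero.2 (Nat.cast_injective.ne hi))] with t ht heq
  refine ht ?_
  rw [hsum t (List.subset_append_left l l'), hsum t (List.subset_append_right l l')] at heq
  simp only [sub_mul, Finset.sum_sub_distrib, heq, sub_self]

open Classical in
theorem measure_le_card_filter_notMem_le {A : Set ℝ} (hA : MeasurableSet A) (s : Finset ι)
    (k : ℕ) : iidLaw ι G {t | k ≤ (s.filter fun i => t i ∉ A).card} ≤ 2 ^ s.card * G Aᶜ ^ k := by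
  have hsub : {t : ι → ℝ | k ≤ (s.filter fun i => t i ∉ A).card} ⊆
      ⋃ r ∈ s.powersetCard k, (r : Set ι).pi fun _ => Aᶜ := fun t ht => by
    obtain ⟨r, hr, hcard⟩ := Finset.exists_subset_card_eq ht
    refine Set.mem_biUnion (x := r) (Finset.mem_powersetCard.2
      ⟨hr.trans (Finset.filter_subset _ _), hcard⟩) fun i hi => (Finset.mem_filter.1 (hr hi)).2
  calc iidLaw ι G {t | k ≤ (s.filter fun i => t i ∉ A).card}
      ≤ ∑ r ∈ s.powersetCard k, iidLaw ι G ((r : Set ι).pi fun _ => Aᶜ) :=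
        (measure_mono hsub).trans (measure_biUnion_finset_le _ _)
    _ = ∑ _ ∈ s.powersetCard k, G Aᶜ ^ k := Finset.sum_congr rfl fun r hr => by
        rw [iidLaw, Measure.infinitePi_pi _ fun _ _ => hA.compl, Finset.prod_const,
          (Finset.mem_powersetCard.1 hr).2]
    _ ≤ 2 ^ s.card * G Aᶜ ^ k := by
        rw [Finset.sum_const, Finset.card_powersetCard, nsmul_eq_mul]
        gcongr
        exact_mod_cast Nat.choose_le_two_pow _ _

open Classical in
/-- Apply `φ` to the weights in `R`. -/
noncomputable def transformOn (R : Finset ι) (φ : ℝ → ℝ) (t : ι → ℝ) : ι → ℝ :=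
  fun i => (if i ∈ R then φ else id) (t i)

theorem transformOn_of_mem {R : Finset ι} {i : ι} (hi : i ∈ R) (φ : ℝ → ℝ) (t : ι → ℝ) :
    transformOn R φ t i = φ (t i) := by
  rw [transformOn, if_pos hi]

theorem transformOn_of_notMem {R : Finset ι} {i : ι} (hi : i ∉ R) (φ : ℝ → ℝ) (t : ι → ℝ) :
    transformOn R φ t i = t i := by
  rw [transformOn, if_neg hi, id]

end IIDLaw

/-- The law of independent weights which have law `G`, tilted by `τ` on `R`. -/
noncomputable def tiltedLaw {ι : Type*} (G : Measure ℝ) [IsProbabilityMeasure G] (τ : ℝ)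
    (R : Finset ι) : Measure (ι → ℝ) :=
  (iidLaw ι G).withDensity fun t => ∏ i ∈ R, tiltDensity G τ (t i)

section TiltedLaw

variable {ι : Type*} {G : Measure ℝ} [IsProbabilityMeasure G] {a b α τ : ℝ} {φ : ℝ → ℝ}

theorem WeightBounds.isProbabilityMeasure_tiltedLaw (hG : WeightBounds G a b α) (h0 : 0 ≤ τ)
    (h1 : τ < 1) (R : Finset ι) : IsProbabilityMeasure (tiltedLaw G τ R) := by
  refine ⟨?_⟩
  have hone : ∫⁻ x, tiltDensity G τ x ∂G = 1 := by
    simpa using hG.lintegral_tiltDensity_pow h0 h1 1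
  rw [tiltedLaw, withDensity_apply _ .univ, Measure.restrict_univ,
    lintegral_prod_infinitePi _ fun _ => measurable_tiltDensity G τ]
  exact Finset.prod_eq_one fun _ _ => hone

theorem WeightBounds.measureReal_le_tiltedLaw_add (hG : WeightBounds G a b α) (h0 : 0 ≤ τ)
    (h1 : τ < 1) {R : Finset ι} {δ : NNReal} (hδ : 0 < δ) (hR : (1 + τ ^ 2) ^ R.card ≤ 1 + δ ^ 2)
    {B : Set (ι → ℝ)} (hB : MeasurableSet B) :
    (iidLaw ι G).real B ≤ (tiltedLaw G τ R).real B + δ := by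
  have hmeas := measurable_tiltDensity G τ
  have hone := (hG.isProbabilityMeasure_tiltedLaw h0 h1 R).measure_univ
  rw [tiltedLaw, withDensity_apply _ .univ, Measure.restrict_univ] at hone
  refine measureReal_le_withDensity_add _ (by fun_prop) hone hδ ?_ hB
  simp only [← Finset.prod_pow]
  rw [lintegral_prod_infinitePi _ fun _ => hmeas.pow_const 2, Finset.prod_const,
    hG.lintegral_tiltDensity_pow h0 h1 2, ← ENNReal.ofReal_pow (by positivity)]
  calc ENNReal.ofReal ((((1 - τ) ^ 2 + (1 + τ) ^ 2) / 2) ^ R.card)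
      ≤ ENNReal.ofReal (1 + δ ^ 2) := by
        refine ENNReal.ofReal_le_ofReal (le_of_eq_of_le ?_ hR)
        ring
    _ = 1 + δ ^ 2 := by
        rw [ENNReal.ofReal_add (by positivity) (by positivity), ENNReal.ofReal_one,
          ENNReal.ofReal_pow (by positivity), ENNReal.ofReal_coe_nnreal]

theorem IsUntilting.map_transformOn_tiltedLaw (h : IsUntilting G a b τ φ)
    (hG : WeightBounds G a b α) (h0 : 0 ≤ τ) (h1 : τ < 1) (R : Finset ι) :
    (tiltedLaw G τ R).map (transformOn R φ) = iidLaw ι G := by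
  classical
  let f : ι → ℝ → ENNReal := fun i => if i ∈ R then tiltDensity G τ else 1
  let ψ : ι → ℝ → ℝ := fun i => if i ∈ R then φ else id
  have hf : ∀ i, Measurable (f i) := fun i => by
    by_cases hi : i ∈ R <;> simp only [f, hi, if_true, if_false]
    exacts [measurable_tiltDensity G τ, measurable_one]
  have hψ : ∀ i, Measurable (ψ i) := fun i => by
    by_cases hi : i ∈ R <;> simp only [ψ, hi, if_true, if_false]
    exacts [h.measurable, measurable_id]
  have hprob : ∀ i, IsProbabilityMeasure (G.withDensity (f i)) := fun i => by
    by_cases hi : i ∈ R <;> simp only [f, hi, if_true, if_false, withDensity_one]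
    exacts [hG.isProbabilityMeasure_withDensity_tiltDensity h0 h1, inferInstance]
  have hlaw : tiltedLaw G τ R = Measure.infinitePi fun i => G.withDensity (f i) := by
    rw [infinitePi_withDensity _ hf R fun i hi => by simp only [f, hi, if_false], tiltedLaw]
    congr with t
    exact Finset.prod_congr rfl fun i hi => by simp only [f, hi, if_true]
  have hmap : ∀ i, (G.withDensity (f i)).map (ψ i) = G := fun i => by
    by_cases hi : i ∈ R <;>
      simp only [f, ψ, hi, if_true, if_false, withDensity_one, h.map_eq, Measure.map_id]
  have := Measure.infinitePi_map_pi (fun i => G.withDensity (f i)) hψ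
  simp only [hmap] at this
  rwa [hlaw]

theorem measurable_transformOn (hφ : Measurable φ) (R : Finset ι) :
    Measurable (transformOn R φ) := by
  classical
  refine measurable_pi_lambda _ fun i => ?_
  by_cases hi : i ∈ R
  · simp only [transformOn_of_mem hi]
    fun_prop
  · simpa only [transformOn_of_notMem hi] using measurable_pi_apply i

theorem IsUntilting.exists_mem_and_transformOn_mem (h : IsUntilting G a b τ φ)
    (hG : WeightBounds G a b α) (h0 : 0 ≤ τ) (h1 : τ < 1) {R : Finset ι} {δ : NNReal}
    (hδ : 0 < δ) (hR : (1 + τ ^ 2) ^ R.card ≤ 1 + δ ^ 2) {E E' : Set (ι → ℝ)}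
    (hE : MeasurableSet E) (hE' : MeasurableSet E')
    (hEE' : (iidLaw ι G).real E'ᶜ + δ < (iidLaw ι G).real E) {P : (ι → ℝ) → Prop}
    (hP : ∀ᵐ t ∂(iidLaw ι G), P t) :
    ∃ t ∈ E, P t ∧ transformOn R φ t ∈ E' ∧ P (transformOn R φ t) := by
  have hprob := hG.isProbabilityMeasure_tiltedLaw h0 h1 R
  have hΦ := measurable_transformOn h.measurable R
  have hlaw := h.map_transformOn_tiltedLaw hG h0 h1 R
  have hP₁ : ∀ᵐ t ∂(tiltedLaw G τ R), P t := (withDensity_absolutelyContinuous _ _).ae_le hP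
  have hP₂ : ∀ᵐ t ∂(tiltedLaw G τ R), P (transformOn R φ t) :=
    ae_of_ae_map hΦ.aemeasurable (hlaw ▸ hP)
  have hlt : (tiltedLaw G τ R).real (transformOn R φ ⁻¹' E'ᶜ) < (tiltedLaw G τ R).real E := by
    rw [← map_measureReal_apply hΦ hE'.compl, hlaw]
    linarith [hG.measureReal_le_tiltedLaw_add h0 h1 hδ hR hE]
  by_contra! hcon
  refine hlt.not_ge (ENNReal.toReal_mono (measure_ne_top _ _) (measure_mono_ae ?_))
  filter_upwards [hP₁, hP₂] with t ht₁ ht₂ htE htE'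
  exact hcon t htE ht₁ htE' ht₂

end TiltedLaw

/-! ### Independent weights on the lattice -/

section LatticeLaw

variable {d : ℕ} {G : Measure ℝ} [IsProbabilityMeasure G] {a b α : ℝ}

theorem WeightBounds.ae_isRegular (hG : WeightBounds G a b α) :
    ∀ᵐ t ∂(iidLaw (Edge d) G), IsRegular a b t := by
  have := hG.nullSingletonClass
  have hmem := ae_forall_mem_iidLaw (ι := Edge d) (mem_ae_iff.2 hG.measure_compl_Icc)
  have hne : ∀ᵐ t ∂(iidLaw (Edge d) G), ∀ (x y : Fin d → ℤ) (p q : (lattice d).Walk x y),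
      p.IsPath → q.IsPath → p ≠ q → passageTime t p ≠ passageTime t q := by
    simp only [ae_all_iff]
    intro x y p q hp hq hpq
    simp only [passageTime_eq_sum_edgeList]
    refine ae_sum_map_ne_of_not_perm fun hperm => hpq ?_
    refine eq_of_edges_subset_of_isPath hq hp fun e he => ?_
    rw [← map_val_edgeList] at he ⊢
    exact (hperm.map Subtype.val).subset he
  filter_upwards [hmem, hne] with t ht ht'
  exact ⟨fun e => (ht e).1, fun e => (ht e).2, ht'⟩

theorem measurable_cast_geodesicCount (S : Set (Fin d → ℤ)) (x y : Fin d → ℤ) :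
    Measurable fun t => (geodesicCount S x y t : ℝ) :=
  measurable_from_top.comp (measurable_geodesicCount S x y)

theorem integral_geodesicCount_comp {Ω : Type*} [MeasurableSpace Ω] {P : Measure Ω}
    {X : Ω → Edge d → ℝ} (hX : HasLaw X (iidLaw (Edge d) G) P) (S : Set (Fin d → ℤ))
    (x y : Fin d → ℤ) : ∫ ω, (geodesicCount S x y (X ω) : ℝ) ∂P =
      ∫ t, (geodesicCount S x y t : ℝ) ∂(iidLaw (Edge d) G) :=
  hX.integral_comp (measurable_cast_geodesicCount S x y).aestronglyMeasurable

theorem WeightBounds.integrable_geodesicCount (hG : WeightBounds G a b α) (S : Set (Fin d → ℤ))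
    (x y : Fin d → ℤ) : Integrable (fun t => (geodesicCount S x y t : ℝ)) (iidLaw (Edge d) G) := by
  refine Integrable.of_bound (measurable_cast_geodesicCount S x y).aestronglyMeasurable
    (b / a * l1Norm (x - y) + 1) ?_
  filter_upwards [hG.ae_isRegular] with t ht
  exact (Real.norm_natCast _).trans_le (geodesicCount_le hG.left_pos ht S x y)

open Classical in
theorem measure_not_fewOutside_le {A : Set ℝ} (hA : MeasurableSet A) (K k : ℕ) :
    iidLaw (Edge d) G {t | ¬FewOutside A K k t} ≤ (2 * (3 ^ d + 1)) ^ K * G Aᶜ ^ k := by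
  have hsub : {t : Edge d → ℝ | ¬FewOutside A K k t} ⊆
      ⋃ l ∈ edgeLists (lattice d) K 0, {t | k ≤ (l.toFinset.filter fun e => t e ∉ A).card} := by
    intro t ht
    simp only [FewOutside, Set.mem_ofPred_eq, not_forall, not_lt] at ht
    obtain ⟨y, p, hp, hlen, hk⟩ := ht
    refine Set.mem_biUnion (x := edgeList p) (edgeList_mem_edgeLists p hlen) ?_
    rw [List.countP_eq_length_filter, ← List.toFinset_card_of_nodup ((nodup_edgeList hp).filter _),
      List.toFinset_filter] at hk
    simpa only [Set.mem_ofPred_eq, decide_eq_true_eq] using hk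
  have hcard : (edgeLists (lattice d) K 0).card ≤ (3 ^ d + 1) ^ K := card_edgeLists_le degree_le K 0
  calc _ ≤ ∑ l ∈ edgeLists (lattice d) K 0,
        iidLaw (Edge d) G {t | k ≤ (l.toFinset.filter fun e => t e ∉ A).card} :=
        (measure_mono hsub).trans (measure_biUnion_finset_le _ _)
    _ ≤ ∑ l ∈ edgeLists (lattice d) K 0, 2 ^ K * G Aᶜ ^ k := by
        refine Finset.sum_le_sum fun l hl => (measure_le_card_filter_notMem_le hA _ k).trans ?_
        gcongr
        · norm_num
        · exact l.toFinset_card_le.trans (length_le_of_mem_edgeLists hl)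
    _ ≤ (3 ^ d + 1) ^ K * (2 ^ K * G Aᶜ ^ k) := by
        rw [Finset.sum_const, nsmul_eq_mul]
        gcongr
        exact_mod_cast hcard
    _ = (2 * (3 ^ d + 1)) ^ K * G Aᶜ ^ k := by
        rw [mul_pow, mul_left_comm, mul_assoc]

section Translation

/-- Translation by `w`, as an automorphism of the lattice. -/
def translation (w : Fin d → ℤ) : lattice d ≃g lattice d where
  toEquiv := Equiv.addRight w
  map_rel_iff' := by simp [lattice]

theorem translation_apply (w x : Fin d → ℤ) : translation w x = x + w := rfl

variable (f : lattice d ≃g lattice d)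

theorem exists_map_eq {x y : Fin d → ℤ} (q : (lattice d).Walk (f x) (f y)) :
    ∃ p : (lattice d).Walk x y, p.map f.toHom = q := by
  refine ⟨(q.map f.symm.toHom).copy (f.symm_apply_apply x) (f.symm_apply_apply y), ?_⟩
  refine SimpleGraph.Walk.ext_support ?_
  rw [SimpleGraph.Walk.support_map, SimpleGraph.Walk.support_copy, SimpleGraph.Walk.support_map,
    List.map_map]
  exact List.map_id'' f.apply_symm_apply _

theorem passageTime_map (t : Edge d → ℝ) {x y : Fin d → ℤ} (p : (lattice d).Walk x y) :
    passageTime t (p.map f.toHom) = passageTime (t ∘ f.toHom.mapEdgeSet) p := by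
  rw [passageTime, passageTime, SimpleGraph.Walk.darts_map, List.map_map]
  rfl

theorem isGeodesic_map_iff (t : Edge d → ℝ) {x y : Fin d → ℤ} (p : (lattice d).Walk x y) :
    IsGeodesic t (p.map f.toHom) ↔ IsGeodesic (t ∘ f.toHom.mapEdgeSet) p := by
  refine ⟨fun h q => ?_, fun h q => ?_⟩
  · simpa only [passageTime_map] using h (q.map f.toHom)
  · obtain ⟨q, rfl⟩ := exists_map_eq f q
    simpa only [passageTime_map] using h q

theorem isUniqueGeodesic_map_iff (t : Edge d → ℝ) {x y : Fin d → ℤ} (p : (lattice d).Walk x y) :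
    IsUniqueGeodesic t (p.map f.toHom) ↔ IsUniqueGeodesic (t ∘ f.toHom.mapEdgeSet) p := by
  refine and_congr (isGeodesic_map_iff f t p) ⟨fun h q hq => ?_, fun h q hq => ?_⟩
  · exact SimpleGraph.Walk.map_injective_of_injective f.injective _ _
      (h _ ((isGeodesic_map_iff f t q).2 hq))
  · obtain ⟨q, rfl⟩ := exists_map_eq f q
    rw [h q ((isGeodesic_map_iff f t q).1 hq)]

theorem geodesicVertices_map (t : Edge d → ℝ) (x y : Fin d → ℤ) :
    geodesicVertices t (f x) (f y) = f '' geodesicVertices (t ∘ f.toHom.mapEdgeSet) x y := by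
  have hsurj : Function.Surjective fun p : (lattice d).Walk x y => p.map f.toHom := exists_map_eq f
  simp only [geodesicVertices_eq_iUnion, Set.image_iUnion]
  refine (Set.iUnion_congr_of_surjective _ hsurj fun p => ?_).symm
  simp only [isUniqueGeodesic_map_iff, SimpleGraph.Walk.support_map, List.mem_map]
  rfl

theorem geodesicCount_map (S : Set (Fin d → ℤ)) (x y : Fin d → ℤ) (t : Edge d → ℝ) :
    geodesicCount S (f x) (f y) t =
      geodesicCount (f ⁻¹' S) x y (t ∘ f.toHom.mapEdgeSet) := by
  rw [geodesicCount, geodesicCount, geodesicVertices_map, ← Set.image_inter_preimage,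
    Set.ncard_image_of_injective _ f.injective]

theorem integral_geodesicCount_map (S : Set (Fin d → ℤ)) (x y : Fin d → ℤ) :
    ∫ t, (geodesicCount S (f x) (f y) t : ℝ) ∂(iidLaw (Edge d) G) =
      ∫ t, (geodesicCount (f ⁻¹' S) x y t : ℝ) ∂(iidLaw (Edge d) G) := by
  have hmap : (iidLaw (Edge d) G).map (· ∘ f.toHom.mapEdgeSet) = iidLaw (Edge d) G :=
    Measure.map_infinitePi_infinitePi_of_inj (P := fun _ : Edge d => G)
      (SimpleGraph.Hom.mapEdgeSet.injective f.toHom f.injective)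
  simp only [geodesicCount_map]
  exact integral_geodesicCount_comp
    ⟨(measurable_pi_lambda _ fun e => measurable_pi_apply _).aemeasurable, hmap⟩ (f ⁻¹' S) x y

end Translation

section Perturbation

variable {C τ : ℝ} {S : Set (Fin d → ℤ)} {R : Finset (Edge d)} {K k : ℕ}

theorem IsUntilting.mul_geodesicCount_sub_le {φ : ℝ → ℝ} (hφ : IsUntilting G a b τ φ)
    (hG : WeightBounds G a b α) (hC : 0 < C) (hR : touching (lattice d) S = R)
    (hS : ∀ u ∈ S, b * l1Norm u < a * K) (h0 : 0 ≤ τ) {t : Edge d → ℝ} (ht : IsRegular a b t)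
    (hfew : FewOutside (tameWeights G C) K k t) (ht' : IsRegular a b (transformOn R φ t))
    (v w : Fin d → ℤ) :
    τ / C ^ 2 * (geodesicCount S 0 v t - k) ≤
      τ / α * (2 * geodesicCount S w (v + w) (transformOn R φ t)) + 4 * b * l1Norm w := by
  have hIcc : ∀ e, t e ∈ Set.Icc a b := fun e => ⟨ht.le e, ht.ge e⟩
  have hmem : ∀ e, e ∈ touching (lattice d) S ↔ e ∈ R := fun e => by rw [hR, Finset.mem_coe]
  refine FPP.mul_geodesicCount_sub_le hG.left_pos (by positivity) (div_nonneg h0 hG.rate_pos.le)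
    ht' ht hS hfew (fun e => ?_) (fun e he htame => ?_) (fun e he => ?_) (fun e he => ?_) v w
  · by_cases he : e ∈ R
    · exact (transformOn_of_mem he φ t).trans_le (hφ.map_le hG h0 (hIcc e))
    · exact (transformOn_of_notMem he φ t).le
  · rw [transformOn_of_mem ((hmem e).1 he)]
    exact hφ.div_sq_le_sub_map hG h0 hC (hIcc e) htame
  · rw [transformOn_of_mem ((hmem e).1 he)]
    exact hφ.sub_map_le hG h0 (hIcc e)
  · exact (transformOn_of_notMem (mt (hmem e).2 he) φ t).symm

theorem WeightBounds.mul_sub_le_of_le_measureReal (hG : WeightBounds G a b α) (hC : 0 < C)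
    (hR : touching (lattice d) S = R) (hS : ∀ u ∈ S, b * l1Norm u < a * K)
    (hfew : (2 * (3 ^ d + 1)) ^ K * G (tameWeights G C)ᶜ ^ k ≤ ENNReal.ofReal (1 / 20))
    (h0 : 0 ≤ τ) (h1 : τ < 1) (hτ : (1 + τ ^ 2) ^ R.card ≤ 1 + (1 / 20) ^ 2)
    {v w : Fin d → ℤ} {N N' : ℝ}
    (hN : 1 / 3 ≤ (iidLaw (Edge d) G).real {t | N ≤ geodesicCount S 0 v t})
    (hN' : (iidLaw (Edge d) G).real {t | geodesicCount S w (v + w) t ≤ N'}ᶜ ≤ 1 / 10) :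
    τ / C ^ 2 * (N - k) ≤ τ / α * (2 * N') + 4 * b * l1Norm w := by
  have := hG.nullSingletonClass
  obtain ⟨φ, hφ⟩ := hG.exists_isUntilting h0 h1
  let B := toMeasurable (iidLaw (Edge d) G) {t | ¬FewOutside (tameWeights G C) K k t}
  have hB : (iidLaw (Edge d) G).real B ≤ 1 / 20 := by
    refine ENNReal.toReal_le_of_le_ofReal (by norm_num) ?_
    rw [measure_toMeasurable]
    exact (measure_not_fewOutside_le measurableSet_tameWeights K k).trans hfew
  have hNB : (iidLaw (Edge d) G).real {t | N ≤ geodesicCount S 0 v t} ≤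
      (iidLaw (Edge d) G).real ({t | N ≤ geodesicCount S 0 v t} \ B) +
        (iidLaw (Edge d) G).real B :=
    (measureReal_mono (by rw [Set.sdiff_union_self]; exact Set.subset_union_left)).trans
      (measureReal_union_le _ _)
  obtain ⟨t, ⟨htN, htB⟩, ht, htN', ht'⟩ := hφ.exists_mem_and_transformOn_mem hG h0 h1 (R := R)
    (δ := 1 / 20) (by positivity) (by simpa using hτ) (E' := {t | geodesicCount S w (v + w) t ≤ N'})
    (E := {t | N ≤ geodesicCount S 0 v t} \ B)
    ((measurableSet_le measurable_const (measurable_cast_geodesicCount S 0 v)).diff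
      (measurableSet_toMeasurable _ _))
    (measurableSet_le (measurable_cast_geodesicCount S w (v + w)) measurable_const)
    (by push_cast; linarith) hG.ae_isRegular
  have hfew : FewOutside (tameWeights G C) K k t :=
    not_not.1 fun h => htB (subset_toMeasurable _ _ h)
  have := hG.rate_pos
  calc τ / C ^ 2 * (N - k) ≤ τ / C ^ 2 * (geodesicCount S 0 v t - k) := by gcongr; exact htN
    _ ≤ _ := hφ.mul_geodesicCount_sub_le hG hC hR hS h0 ht hfew ht' v w
    _ ≤ τ / α * (2 * N') + 4 * b * l1Norm w := by gcongr; exact htN'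

end Perturbation

end LatticeLaw

/-! ### Cylinders around lattice directions -/

section Cylinder

variable {d : ℕ}

theorem toEuclid_apply (x : Fin d → ℤ) (i : Fin d) : toEuclid x i = x i := rfl

theorem toEuclid_add (x y : Fin d → ℤ) : toEuclid (x + y) = toEuclid x + toEuclid y := by
  ext i; simp [toEuclid]

theorem toEuclid_single (i : Fin d) (z : ℤ) :
    toEuclid (Pi.single i z) = EuclideanSpace.single i (z : ℝ) := by
  ext j
  obtain rfl | hj := eq_or_ne j i
  · simp [toEuclid]
  · simp [toEuclid, hj]

theorem norm_toEuclid_sq (x : Fin d → ℤ) : ‖toEuclid x‖ ^ 2 = ∑ i, (x i : ℝ) ^ 2 := by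
  simp [EuclideanSpace.norm_sq_eq, toEuclid]

theorem l1Norm_le_mul_norm_toEuclid (x : Fin d → ℤ) : (l1Norm x : ℝ) ≤ d * ‖toEuclid x‖ := by
  have hcoord : ∀ i ∈ Finset.univ, |(x i : ℝ)| ≤ ‖toEuclid x‖ := fun i _ =>
    PiLp.norm_apply_le (toEuclid x) i
  rw [cast_l1Norm]
  simpa using Finset.sum_le_card_nsmul _ _ _ hcoord

theorem norm_toEuclid_le_l1Norm (x : Fin d → ℤ) : ‖toEuclid x‖ ≤ l1Norm x := by
  refine le_of_sq_le_sq ?_ (Nat.cast_nonneg _)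
  rw [norm_toEuclid_sq, cast_l1Norm]
  simpa only [sq_abs] using
    Finset.sum_sq_le_sq_sum_of_nonneg fun i _ => abs_nonneg (x i : ℝ)

/-- The coordinate of `u` along the direction of `v`. -/
noncomputable def height (v u : Fin d → ℤ) : ℝ :=
  inner ℝ (toEuclid u) (‖toEuclid v‖⁻¹ • toEuclid v)

theorem height_add (v x y : Fin d → ℤ) : height v (x + y) = height v x + height v y := by
  rw [height, toEuclid_add, inner_add_left, height, height]

theorem height_zero (v : Fin d → ℤ) : height v 0 = 0 := by
  simpa using height_add v 0 0

theorem height_self (v : Fin d → ℤ) : height v v = ‖toEuclid v‖ := by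
  rw [height, inner_smul_right, real_inner_self_eq_norm_mul_norm, ← mul_assoc,
    inv_mul_mul_self]

theorem norm_inv_norm_smul_le_one {E : Type*} [SeminormedAddCommGroup E] [NormedSpace ℝ E] (w : E) :
    ‖‖w‖⁻¹ • w‖ ≤ 1 := by
  rw [norm_smul, norm_inv, norm_norm]
  exact inv_mul_le_one

theorem abs_height_le (v u : Fin d → ℤ) : |height v u| ≤ ‖toEuclid u‖ :=
  (abs_real_inner_le_norm _ _).trans
    (mul_le_of_le_one_right (norm_nonneg _) (norm_inv_norm_smul_le_one _))

theorem height_le_add_one_of_adj (v : Fin d → ℤ) {x y : Fin d → ℤ} (h : (lattice d).Adj x y) :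
    height v y ≤ height v x + 1 := by
  rw [adj_iff_l1Norm, l1Norm_sub_comm] at h
  calc height v y = height v x + height v (y - x) := by rw [← height_add, add_sub_cancel]
    _ ≤ height v x + l1Norm (y - x) := by
        gcongr
        exact (le_abs_self _).trans ((abs_height_le v _).trans (norm_toEuclid_le_l1Norm _))
    _ = height v x + 1 := by rw [h, Nat.cast_one]

theorem norm_sub_height_smul_le {v u : Fin d → ℤ} {r : ℝ} (hu : toEuclid u ∈ cyl (toEuclid v) r) :
    ‖toEuclid u - height v u • ‖toEuclid v‖⁻¹ • toEuclid v‖ ≤ r := by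
  obtain ⟨s, hs⟩ := hu
  have hproj : (ℝ ∙ toEuclid v).starProjection (toEuclid u) =
      height v u • ‖toEuclid v‖⁻¹ • toEuclid v := by
    rw [Submodule.starProjection_singleton, height, smul_smul, inner_smul_right, real_inner_comm]
    congr 1
    simp only [RCLike.ofReal_real_eq_id, id_eq]
    ring
  rw [← hproj, Submodule.starProjection_minimal]
  have hmem : s • toEuclid v ∈ ℝ ∙ toEuclid v :=
    Submodule.smul_mem _ s (Submodule.mem_span_singleton_self _)
  have hbdd : BddBelow (Set.range fun x : ℝ ∙ toEuclid v => ‖toEuclid u - x‖) :=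
    ⟨0, Set.forall_mem_range.2 fun _ => norm_nonneg _⟩
  exact (ciInf_le hbdd ⟨_, hmem⟩).trans hs

theorem norm_toEuclid_le_of_mem_cyl {v u : Fin d → ℤ} {r : ℝ}
    (hu : toEuclid u ∈ cyl (toEuclid v) r) : ‖toEuclid u‖ ≤ |height v u| + r := by
  refine (norm_le_norm_add_norm_sub' _ (height v u • ‖toEuclid v‖⁻¹ • toEuclid v)).trans ?_
  gcongr
  · rw [norm_smul, Real.norm_eq_abs]
    exact mul_le_of_le_one_right (abs_nonneg _) (norm_inv_norm_smul_le_one _)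
  · exact norm_sub_height_smul_le hu

/-- The part of the cylinder of radius `r` around the direction of `v` which lies between the
heights `s` and `s'`. -/
def cylSegment (v : Fin d → ℤ) (r s s' : ℝ) : Set (Fin d → ℤ) :=
  height v ⁻¹' Set.Icc s s' ∩ toEuclid ⁻¹' cyl (toEuclid v) r

theorem card_Icc_ceil_floor_le (c : ℝ) {s : ℝ} (hs : 0 ≤ s) :
    ((Finset.Icc ⌈c - s⌉ ⌊c + s⌋).card : ℝ) ≤ 2 * s + 1 := by
  have hle : ((⌊c + s⌋ + 1 - ⌈c - s⌉ : ℤ) : ℝ) ≤ 2 * s + 1 := by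
    push_cast
    linarith [Int.floor_le (c + s), Int.le_ceil (c - s)]
  calc ((Finset.Icc ⌈c - s⌉ ⌊c + s⌋).card : ℝ)
      = ((max (⌊c + s⌋ + 1 - ⌈c - s⌉) 0 : ℤ) : ℝ) := by
        rw [Int.card_Icc, ← Int.toNat_eq_max, Int.cast_natCast]
    _ ≤ 2 * s + 1 := by
        rw [Int.cast_max]
        exact max_le hle (by push_cast; positivity)

theorem exists_finset_forall_norm_sub_le (c : EuclideanSpace ℝ (Fin d)) {s : ℝ} (hs : 0 ≤ s) :
    ∃ Q : Finset (Fin d → ℤ), (∀ u, ‖toEuclid u - c‖ ≤ s → u ∈ Q) ∧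
      (Q.card : ℝ) ≤ (2 * s + 1) ^ d := by
  refine ⟨Fintype.piFinset fun i => Finset.Icc ⌈c i - s⌉ ⌊c i + s⌋, fun u hu => ?_, ?_⟩
  · rw [Fintype.mem_piFinset]
    intro i
    have hi : |(u i : ℝ) - c i| ≤ s := (PiLp.norm_apply_le (toEuclid u - c) i).trans hu
    rw [abs_le] at hi
    exact Finset.mem_Icc.2 ⟨Int.ceil_le.2 (by linarith), Int.le_floor.2 (by linarith)⟩
  · rw [Fintype.card_piFinset, Nat.cast_prod]
    refine (Finset.prod_le_prod (fun _ _ => Nat.cast_nonneg _)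
      fun i _ => card_Icc_ceil_floor_le (c i) hs).trans ?_
    simp

theorem exists_norm_sub_natCast_mul_smul_le {v u : Fin d → ℤ} {r s s' : ℝ} (hr : 0 < r)
    (hs : 0 ≤ s) (hu : u ∈ cylSegment v r s s') : ∃ k ≤ ⌊s' / r⌋₊,
      ‖toEuclid u - (k * r) • ‖toEuclid v‖⁻¹ • toEuclid v‖ ≤ 2 * r := by
  obtain ⟨⟨hus, hus'⟩, hcyl⟩ := hu
  refine ⟨⌊height v u / r⌋₊, Nat.floor_mono (by gcongr), ?_⟩
  have hle := Nat.floor_le (div_nonneg (hs.trans hus) hr.le)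
  have hlt := Nat.lt_floor_add_one (height v u / r)
  set k := ⌊height v u / r⌋₊
  rw [le_div_iff₀ hr] at hle
  rw [div_lt_iff₀ hr] at hlt
  set e := ‖toEuclid v‖⁻¹ • toEuclid v
  have hdiff : ‖(height v u - k * r) • e‖ ≤ r := by
    rw [norm_smul, Real.norm_eq_abs, abs_of_nonneg (by linarith)]
    refine (mul_le_of_le_one_right (by linarith) (norm_inv_norm_smul_le_one _)).trans ?_
    linarith
  calc ‖toEuclid u - (k * r) • e‖
      = ‖(toEuclid u - height v u • e) + (height v u - k * r) • e‖ := by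
        rw [sub_smul, sub_add_sub_cancel]
    _ ≤ r + r := (norm_add_le _ _).trans (add_le_add (norm_sub_height_smul_le hcyl) hdiff)
    _ = 2 * r := (two_mul r).symm

theorem exists_finset_cylSegment (hd : 1 ≤ d) (v : Fin d → ℤ) {r s s' : ℝ} (hr : 1 ≤ r)
    (hs : 0 ≤ s) (hrs' : r ≤ s') : ∃ Q : Finset (Fin d → ℤ), cylSegment v r s s' ⊆ Q ∧
      (Q.card : ℝ) ≤ 2 * 5 ^ d * (s' * r ^ (d - 1)) := by
  classical
  have hr0 : 0 < r := by linarith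
  choose Q hQ hcard using fun k : ℕ => exists_finset_forall_norm_sub_le
    ((k * r) • ‖toEuclid v‖⁻¹ • toEuclid v) (s := 2 * r) (by positivity)
  refine ⟨(Finset.range (⌊s' / r⌋₊ + 1)).biUnion Q, fun u hu => ?_, ?_⟩
  · obtain ⟨k, hk, hnorm⟩ := exists_norm_sub_natCast_mul_smul_le hr0 hs hu
    exact Finset.mem_biUnion.2 ⟨k, Finset.mem_range_succ_iff.2 hk, hQ k u hnorm⟩
  · have hfloor : (⌊s' / r⌋₊ : ℝ) + 1 ≤ 2 * (s' / r) := by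
      have := Nat.floor_le (div_nonneg (hr0.le.trans hrs') hr0.le)
      have := (one_le_div hr0).2 hrs'
      linarith
    calc (((Finset.range (⌊s' / r⌋₊ + 1)).biUnion Q).card : ℝ)
        ≤ ∑ k ∈ Finset.range (⌊s' / r⌋₊ + 1), ((Q k).card : ℝ) := by
          exact_mod_cast Finset.card_biUnion_le
      _ ≤ ∑ _k ∈ Finset.range (⌊s' / r⌋₊ + 1), (5 * r) ^ d := by
          gcongr with k
          refine (hcard k).trans ?_
          gcongr
          linarith
      _ = (⌊s' / r⌋₊ + 1) * (5 * r) ^ d := by simp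
      _ ≤ 2 * (s' / r) * (5 * r) ^ d := by gcongr
      _ = 2 * 5 ^ d * (s' * r ^ (d - 1)) := by
          rw [mul_pow, ← Nat.sub_add_cancel hd, pow_succ r, Nat.add_sub_cancel]
          field_simp

theorem exists_finset_touching_eq {S : Set (Fin d → ℤ)} {Q : Finset (Fin d → ℤ)} (hSQ : S ⊆ Q) :
    ∃ R : Finset (Edge d), touching (lattice d) S = R ∧ R.card ≤ Q.card * 3 ^ d := by
  classical
  let Q' : Finset (Sym2 (Fin d → ℤ)) := Q.biUnion fun u => (box u).image fun y => s(u, y)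
  have hmaps : Set.MapsTo Subtype.val (touching (lattice d) S) Q' := by
    rintro ⟨e, he⟩ ⟨u, hu, y, rfl⟩
    exact Finset.mem_biUnion.2
      ⟨u, hSQ hu, Finset.mem_image.2 ⟨y, neighborSet_subset_box u he, rfl⟩⟩
  have hfin : (touching (lattice d) S).Finite :=
    .of_finite_image (Q'.finite_toSet.subset hmaps.image_subset) Subtype.val_injective.injOn
  refine ⟨hfin.toFinset, hfin.coe_toFinset.symm, ?_⟩
  calc hfin.toFinset.card ≤ Q'.card := Finset.card_le_card_of_injOn Subtype.val
        (fun e he => hmaps (hfin.mem_toFinset.1 he)) Subtype.val_injective.injOn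
    _ ≤ Q.card * 3 ^ d := Finset.card_biUnion_le_card_mul _ _ _ fun u _ =>
        Finset.card_image_le.trans (card_box u).le

/-- The `i`-th coordinate direction makes an angle of at least `π / 4` with `v`. -/
def IsTransversal (v : Fin d → ℤ) (i : Fin d) : Prop :=
  2 * (v i : ℝ) ^ 2 ≤ ‖toEuclid v‖ ^ 2

theorem exists_isTransversal (hd : 2 ≤ d) (v : Fin d → ℤ) : ∃ i, IsTransversal v i := by
  have : Nontrivial (Fin d) := Fin.nontrivial_iff_two_le.2 hd
  obtain ⟨i, j, hij⟩ := exists_pair_ne (Fin d)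
  have hpair : (v i : ℝ) ^ 2 + (v j : ℝ) ^ 2 ≤ ‖toEuclid v‖ ^ 2 := by
    rw [norm_toEuclid_sq, ← Finset.sum_pair (f := fun i => (v i : ℝ) ^ 2) hij]
    exact Finset.sum_le_sum_of_subset_of_nonneg (Finset.subset_univ _) fun _ _ _ => sq_nonneg _
  obtain hle | hle := le_total ((v i : ℝ) ^ 2) ((v j : ℝ) ^ 2)
  · exact ⟨i, show _ ≤ _ by linarith⟩
  · exact ⟨j, show _ ≤ _ by linarith⟩

theorem IsTransversal.sq_le {v : Fin d → ℤ} {i : Fin d} (hi : IsTransversal v i) (z s : ℝ) :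
    z ^ 2 ≤ 2 * ‖EuclideanSpace.single i z - s • toEuclid v‖ ^ 2 := by
  have hmul : s ^ 2 * (2 * (v i : ℝ) ^ 2) ≤ s ^ 2 * ‖toEuclid v‖ ^ 2 := by
    gcongr
    exact hi
  rw [norm_sub_sq_real, PiLp.norm_single, inner_smul_right, EuclideanSpace.inner_single_left,
    norm_smul, mul_pow, Real.norm_eq_abs, sq_abs, Real.norm_eq_abs, sq_abs]
  rw [conj_trivial, toEuclid_apply]
  nlinarith [sq_nonneg (2 * s * v i - z)]

theorem IsTransversal.eq_of_mem_cyl {v : Fin d → ℤ} {i : Fin d} (hi : IsTransversal v i) {r : ℝ}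
    {k : ℕ} (hr : 0 < r) (hk : 3 * r ≤ k) {u : Fin d → ℤ} {j j' : ℤ}
    (h : toEuclid (u + Pi.single i (j * k)) ∈ cyl (toEuclid v) r)
    (h' : toEuclid (u + Pi.single i (j' * k)) ∈ cyl (toEuclid v) r) : j = j' := by
  obtain ⟨s, hs⟩ := h
  obtain ⟨s', hs'⟩ := h'
  have hnorm : ‖EuclideanSpace.single i (((j - j') * k : ℤ) : ℝ) - (s - s') • toEuclid v‖ ≤
      2 * r := by
    have hsplit : EuclideanSpace.single i (((j - j') * k : ℤ) : ℝ) - (s - s') • toEuclid v =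
        (toEuclid (u + Pi.single i (j * k)) - s • toEuclid v) -
          (toEuclid (u + Pi.single i (j' * k)) - s' • toEuclid v) := by
      ext l
      simp only [PiLp.sub_apply, PiLp.smul_apply, ← toEuclid_single, toEuclid_apply, Pi.add_apply,
        sub_mul, Pi.single_sub, Pi.sub_apply, smul_eq_mul]
      push_cast
      ring
    rw [hsplit]
    linarith [norm_sub_le (toEuclid (u + Pi.single i (j * k)) - s • toEuclid v)
      (toEuclid (u + Pi.single i (j' * k)) - s' • toEuclid v)]
  by_contra hne
  have hone : (1 : ℝ) ≤ ((j - j' : ℤ) : ℝ) ^ 2 := by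
    exact_mod_cast Int.add_one_le_of_lt (sq_pos_of_ne_zero (sub_ne_zero.2 hne))
  have := calc (3 * r) ^ 2 ≤ 1 * (k : ℝ) ^ 2 := by rw [one_mul]; gcongr
    _ ≤ ((j - j' : ℤ) : ℝ) ^ 2 * (k : ℝ) ^ 2 := by gcongr
    _ = (((j - j') * k : ℤ) : ℝ) ^ 2 := by push_cast; ring
    _ ≤ 2 * ‖_‖ ^ 2 := hi.sq_le _ (s - s')
    _ ≤ 2 * (2 * r) ^ 2 := by gcongr
  nlinarith

end Cylinder

/-! ### The number of vertices outside the cylinder -/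

section OutsideCylinder

variable {d : ℕ}

/-- The vertices of the slab between the heights `0` and `ℓ` which lie outside the cylinder of
radius `r` around the direction of `v`. -/
def slabOutsideCyl (v : Fin d → ℤ) (r ℓ : ℝ) : Set (Fin d → ℤ) :=
  {u | 0 ≤ height v u ∧ height v u ≤ ℓ ∧ toEuclid u ∉ cyl (toEuclid v) r}

theorem IsRegular.sub_le_geodesicCount_add {a b : ℝ} (ha : 0 < a) {t : Edge d → ℝ}
    (ht : IsRegular a b t) {v : Fin d → ℤ} {s ℓ : ℝ} (hs : 0 ≤ s) (hℓ : ℓ ≤ ‖toEuclid v‖) (r : ℝ) :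
    ℓ - 2 * s - 1 ≤ geodesicCount (cylSegment v r s (ℓ - s)) 0 v t +
      geodesicCount (slabOutsideCyl v r ℓ) 0 v t := by
  obtain ⟨p, hp, -⟩ := ht.exists_isUniqueGeodesic ha 0 v
  have hcross := le_ncard_support_inter_preimage_Icc p (a := s) (b := ℓ - s)
    (fun x y => height_le_add_one_of_adj v) (by simpa only [height_zero] using hs)
    (by rw [height_self]; linarith)
  have hcover : height v ⁻¹' Set.Icc s (ℓ - s) ⊆
      cylSegment v r s (ℓ - s) ∪ slabOutsideCyl v r ℓ := by
    rintro u ⟨hu, hu'⟩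
    by_cases hcyl : toEuclid u ∈ cyl (toEuclid v) r
    · exact .inl ⟨⟨hu, hu'⟩, hcyl⟩
    · exact .inr ⟨hs.trans hu, by linarith, hcyl⟩
  calc ℓ - 2 * s - 1 = ℓ - s - s - 1 := by ring
    _ ≤ geodesicCount (height v ⁻¹' Set.Icc s (ℓ - s)) 0 v t := by
        rwa [geodesicCount, hp.geodesicVertices_eq]
    _ ≤ geodesicCount (cylSegment v r s (ℓ - s)) 0 v t +
          geodesicCount (slabOutsideCyl v r ℓ) 0 v t :=
        mod_cast (geodesicCount_mono hcover 0 v t).trans (geodesicCount_union_le _ _ 0 v t)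

theorem l1Norm_single (i : Fin d) (z : ℤ) : (l1Norm (Pi.single i z) : ℝ) = |(z : ℝ)| := by
  rw [cast_l1Norm, Finset.sum_eq_single i (fun j _ hj => by simp [hj]) (by simp),
    Pi.single_eq_same]

theorem IsTransversal.pairwise_disjoint {v : Fin d → ℤ} {i : Fin d} (hi : IsTransversal v i)
    {r : ℝ} {k : ℕ} (hr : 0 < r) (hk : 3 * r ≤ k) (s s' : ℝ) :
    Pairwise (Function.onFun Disjoint fun j : ℤ =>
      translation (Pi.single i (j * k)) ⁻¹' cylSegment v r s s') := fun _ _ hne =>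
  Set.disjoint_left.2 fun _ hu hu' => hne (hi.eq_of_mem_cyl hr hk hu.2 hu'.2)

theorem IsTransversal.preimage_cylSegment_subset {v : Fin d → ℤ} {i : Fin d}
    (hi : IsTransversal v i) {r : ℝ} {k : ℕ} (hr : 0 < r) (hk : 3 * r ≤ k) {j : ℤ} (hj : j ≠ 0)
    {s : ℝ} (hs : l1Norm (Pi.single i (j * k)) ≤ s) (ℓ : ℝ) :
    translation (Pi.single i (j * k)) ⁻¹' cylSegment v r s (ℓ - s) ⊆ slabOutsideCyl v r ℓ := by
  rintro u ⟨hu, hcyl⟩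
  rw [Set.mem_preimage, translation_apply, height_add] at hu
  have hheight := abs_le.1 <| (abs_height_le v (Pi.single i (j * k))).trans <|
    (norm_toEuclid_le_l1Norm _).trans hs
  refine ⟨by linarith [hu.1, hheight.2], by linarith [hu.2, hheight.1], fun hcyl' => hj ?_⟩
  exact hi.eq_of_mem_cyl hr hk hcyl (by simpa using hcyl')

theorem one_add_pow_le {x : ℝ} (hx : 0 ≤ x) {n : ℕ} (h : n * x ≤ 1) :
    (1 + x) ^ n ≤ 1 + 2 * (n * x) := by
  have hexp := Real.abs_exp_sub_one_le (x := n * x) (by rwa [abs_of_nonneg (by positivity)])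
  rw [abs_of_nonneg (a := n * x) (by positivity)] at hexp
  calc (1 + x) ^ n ≤ Real.exp x ^ n := by
        gcongr
        linarith [Real.add_one_le_exp x]
    _ = Real.exp (n * x) := (Real.exp_nat_mul x n).symm
    _ ≤ 1 + 2 * (n * x) := by linarith [le_abs_self (Real.exp (n * x) - 1)]

theorem measureReal_compl_setOf_le_le {Ω : Type*} [MeasurableSpace Ω] {μ : Measure Ω} {f : Ω → ℝ}
    (hf : 0 ≤ f) (hi : Integrable f μ) {ε p : ℝ} (hε : 0 < ε) (h : ∫ ω, f ω ∂μ ≤ p * ε) :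
    μ.real {ω | f ω ≤ ε}ᶜ ≤ p := by
  have hmono : μ.real {ω | f ω ≤ ε}ᶜ ≤ μ.real {ω | ε ≤ f ω} :=
    measureReal_mono (fun ω => le_of_not_ge (α := ℝ)) (hi.measure_ge_lt_top hε).ne
  have hmarkov := mul_meas_ge_le_integral_of_nonneg (ae_of_all μ hf) hi ε
  exact hmono.trans (le_of_mul_le_mul_left (by linarith) hε)

variable {G : Measure ℝ} [IsProbabilityMeasure G] {a b α : ℝ} {v : Fin d → ℤ} {r ℓ : ℝ} {m : ℕ}

theorem WeightBounds.exists_integral_geodesicCount_add_le (hG : WeightBounds G a b α) (hd : 2 ≤ d)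
    (hr : 1 ≤ r) (hm : 0 < m) {D : ℝ}
    (hout : ∫ t, (geodesicCount (slabOutsideCyl v r ℓ) 0 v t : ℝ) ∂(iidLaw (Edge d) G) ≤ D) :
    ∃ w : Fin d → ℤ, l1Norm w ≤ 4 * m * r ∧
      ∫ t, (geodesicCount (cylSegment v r (4 * m * r) (ℓ - 4 * m * r)) w (v + w) t : ℝ)
        ∂(iidLaw (Edge d) G) ≤ D / m := by
  obtain ⟨i, hi⟩ := exists_isTransversal hd v
  have hr0 : 0 < r := by linarith
  have hk : 3 * r ≤ ⌈3 * r⌉₊ := Nat.le_ceil _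
  have hk' : (⌈3 * r⌉₊ : ℝ) ≤ 4 * r := by
    linarith [Nat.ceil_lt_add_one (a := 3 * r) (by positivity)]
  set k := ⌈3 * r⌉₊
  let w (j : ℤ) : Fin d → ℤ := Pi.single i (j * k)
  set S := cylSegment v r (4 * m * r) (ℓ - 4 * m * r)
  have hpos : ∀ j ∈ Finset.Icc (1 : ℤ) m, 0 < j := fun j hj =>
    zero_lt_one.trans_le (Finset.mem_Icc.1 hj).1
  have hw : ∀ j ∈ Finset.Icc (1 : ℤ) m, (l1Norm (w j) : ℝ) ≤ 4 * m * r := fun j hj => by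
    have hj0 : (0 : ℝ) ≤ j := mod_cast (hpos j hj).le
    have hjm : (j : ℝ) ≤ m := mod_cast (Finset.mem_Icc.1 hj).2
    rw [l1Norm_single]
    push_cast
    rw [abs_of_nonneg (by positivity)]
    calc (j : ℝ) * k ≤ m * (4 * r) := by gcongr
      _ = 4 * m * r := by ring
  have hsum : ∑ j ∈ Finset.Icc (1 : ℤ) m,
      ∫ t, (geodesicCount S (w j) (v + w j) t : ℝ) ∂(iidLaw (Edge d) G) ≤
      ∑ _j ∈ Finset.Icc (1 : ℤ) m, D / m := by
    have hshift (j : ℤ) := integral_geodesicCount_map (G := G) (translation (w j)) S 0 v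
    simp only [translation_apply, zero_add] at hshift
    simp only [hshift]
    rw [← integral_finsetSum _ fun j _ => hG.integrable_geodesicCount _ _ _]
    have hD : ∑ _j ∈ Finset.Icc (1 : ℤ) m, D / m = D := by
      simp [mul_div_cancel₀ D (Nat.cast_ne_zero.2 hm.ne')]
    rw [hD]
    refine (integral_mono (integrable_finsetSum _ fun j _ => hG.integrable_geodesicCount _ _ _)
      (hG.integrable_geodesicCount _ _ _) fun t => ?_).trans hout
    refine (Nat.cast_sum _ _).ge.trans (Nat.cast_le.2 ?_)
    exact sum_geodesicCount_le _ ((hi.pairwise_disjoint hr0 hk _ _).set_pairwise _)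
      (fun j hj => hi.preimage_cylSegment_subset hr0 hk (hpos j hj).ne' (hw j hj) ℓ) 0 v t
  obtain ⟨j, hj, hle⟩ := Finset.exists_le_of_sum_le ⟨1, by simp; lia⟩ hsum
  exact ⟨w j, hw j hj, hle⟩

theorem l1Norm_le_of_mem_cylSegment {u : Fin d → ℤ} {s s' : ℝ} (hs : 0 ≤ s)
    (hu : u ∈ cylSegment v r s s') : (l1Norm u : ℝ) ≤ d * (s' + r) := by
  have hnorm := norm_toEuclid_le_of_mem_cyl hu.2
  rw [abs_of_nonneg (hs.trans hu.1.1)] at hnorm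
  refine (l1Norm_le_mul_norm_toEuclid u).trans ?_
  gcongr
  linarith [hu.1.2]

theorem exists_finset_touching_cylSegment_eq (hd : 1 ≤ d) (v : Fin d → ℤ) (hr : 1 ≤ r) {s s' : ℝ}
    (hs : 0 ≤ s) (hrs' : r ≤ s') :
    ∃ R : Finset (Edge d), touching (lattice d) (cylSegment v r s s') = R ∧
      (R.card : ℝ) ≤ 2 * 15 ^ d * (s' * r ^ (d - 1)) := by
  obtain ⟨Q, hQ, hQcard⟩ := exists_finset_cylSegment hd v hr hs hrs'
  obtain ⟨R, hR, hRcard⟩ := exists_finset_touching_eq hQ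
  refine ⟨R, hR, ?_⟩
  calc (R.card : ℝ) ≤ Q.card * 3 ^ d := mod_cast hRcard
    _ ≤ 2 * 5 ^ d * (s' * r ^ (d - 1)) * 3 ^ d := by gcongr
    _ = 2 * 15 ^ d * (s' * r ^ (d - 1)) := by
        rw [show (15 : ℝ) = 5 * 3 by norm_num, mul_pow]
        ring

theorem WeightBounds.third_le_measureReal (hG : WeightBounds G a b α) {s : ℝ} (hs : 0 ≤ s)
    (hℓ0 : 0 < ℓ) (hℓ : ℓ ≤ ‖toEuclid v‖)
    (hout : ∫ t, (geodesicCount (slabOutsideCyl v r ℓ) 0 v t : ℝ) ∂(iidLaw (Edge d) G) ≤ ℓ / 2) :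
    1 / 3 ≤ (iidLaw (Edge d) G).real
      {t | ℓ / 4 - 2 * s - 1 ≤ geodesicCount (cylSegment v r s (ℓ - s)) 0 v t} := by
  set E := {t : Edge d → ℝ | (geodesicCount (slabOutsideCyl v r ℓ) 0 v t : ℝ) ≤ 3 / 4 * ℓ}
  have hE : (iidLaw (Edge d) G).real Eᶜ ≤ 2 / 3 :=
    measureReal_compl_setOf_le_le (fun _ => Nat.cast_nonneg _) (hG.integrable_geodesicCount _ _ _)
      (by positivity) (by linarith)
  rw [probReal_compl_eq_one_sub
    (measurableSet_le (measurable_cast_geodesicCount _ _ _) measurable_const)] at hE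
  refine (by linarith : 1 / 3 ≤ (iidLaw (Edge d) G).real E).trans ?_
  refine ENNReal.toReal_mono (measure_ne_top _ _) (measure_mono_ae ?_)
  filter_upwards [hG.ae_isRegular] with t ht hout'
  have hsum := ht.sub_le_geodesicCount_add hG.left_pos hs hℓ r
  have hle : (geodesicCount (slabOutsideCyl v r ℓ) 0 v t : ℝ) ≤ 3 / 4 * ℓ := hout'
  exact (by linarith : ℓ / 4 - 2 * s - 1 ≤ (geodesicCount (cylSegment v r s (ℓ - s)) 0 v t : ℝ))

theorem mul_le_of_div_mul_le {τ C m N L : ℝ} (hα : 0 < α) (hb : 0 ≤ b) (hC : 0 < C) (hm : 0 < m)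
    (hℓ : 0 ≤ ℓ) (h0 : 0 ≤ τ) (hCm : 160 * C ^ 2 ≤ α * m) (hN : ℓ / 8 ≤ N) (hL : L ≤ 4 * m * r)
    (h : τ / C ^ 2 * N ≤ τ * ℓ * (10 / (α * m)) + 4 * b * L) :
    τ * ℓ ≤ 256 * b * m * C ^ 2 * r := by
  have hdiv : τ / C ^ 2 * (ℓ / 8) ≤ τ * ℓ / (16 * C ^ 2) + 16 * b * m * r :=
    calc τ / C ^ 2 * (ℓ / 8) ≤ τ / C ^ 2 * N := by gcongr
      _ ≤ τ * ℓ * (10 / (α * m)) + 4 * b * L := h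
      _ ≤ τ * ℓ * (1 / (16 * C ^ 2)) + 4 * b * (4 * m * r) := by
          gcongr τ * ℓ * ?_ + _ * ?_
          rw [div_le_div_iff₀ (by positivity) (by positivity)]
          linarith
      _ = τ * ℓ / (16 * C ^ 2) + 16 * b * m * r := by ring
  field_simp at hdiv
  linarith

theorem WeightBounds.tilt_mul_le (hG : WeightBounds G a b α) (hd : 2 ≤ d) (hm : 0 < m) (hr : 1 ≤ r)
    (hrℓ : 400 * m * r ≤ ℓ) (hℓ : ℓ ≤ ‖toEuclid v‖) {C : ℝ} (hC : 0 < C)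
    (hCm : 160 * C ^ 2 ≤ α * m) {K k : ℕ} (hK : 2 * b * d * ℓ < a * K) (hk : k + 1 ≤ ℓ / 10)
    (hfew : (2 * (3 ^ d + 1)) ^ K * G (tameWeights G C)ᶜ ^ k ≤ ENNReal.ofReal (1 / 20)) {τ : ℝ}
    (h0 : 0 ≤ τ) (h1 : τ < 1)
    (hτ : 2 * 15 ^ d * (ℓ * r ^ (d - 1)) * τ ^ 2 ≤ 1 / 800)
    (hout : ∫ t, (geodesicCount (slabOutsideCyl v r ℓ) 0 v t : ℝ) ∂(iidLaw (Edge d) G) ≤ ℓ / 2) :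
    τ * ℓ ≤ 256 * b * m * C ^ 2 * r := by
  have hα := hG.rate_pos
  have hb : 0 < b := hG.left_pos.trans hG.left_lt_right
  have hm1 : (1 : ℝ) ≤ m := mod_cast hm
  have hrm : r ≤ m * r := le_mul_of_one_le_left (by linarith) hm1
  set s := 4 * m * r
  have hs : 0 ≤ s := by positivity
  have hℓ0 : 0 < ℓ := by linarith
  have : 100 * s ≤ ℓ := by simp only [s]; linarith
  obtain ⟨w, hw, hwint⟩ := hG.exists_integral_geodesicCount_add_le hd hr hm hout
  obtain ⟨R, hR, hRcard⟩ := exists_finset_touching_cylSegment_eq (by lia) v hr hs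
    (show r ≤ ℓ - s by simp only [s]; linarith)
  have hRτ : R.card * τ ^ 2 ≤ 1 / 800 := by
    refine le_trans ?_ hτ
    gcongr
    refine hRcard.trans ?_
    gcongr
    linarith
  have hS : ∀ u ∈ cylSegment v r s (ℓ - s), b * l1Norm u < a * K := fun u hu =>
    calc b * l1Norm u ≤ b * (d * (ℓ - s + r)) := by
          gcongr
          exact l1Norm_le_of_mem_cylSegment hs hu
      _ ≤ b * (d * (2 * ℓ)) := by gcongr; linarith
      _ < a * K := lt_of_eq_of_lt (by ring) hK
  have hrare : (iidLaw (Edge d) G).real {t | (geodesicCount (cylSegment v r s (ℓ - s)) w (v + w) t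
      : ℝ) ≤ 5 * ℓ / m}ᶜ ≤ 1 / 10 :=
    measureReal_compl_setOf_le_le (fun _ => Nat.cast_nonneg _) (hG.integrable_geodesicCount _ _ _)
      (by positivity) (hwint.trans_eq (by ring))
  have hmain := hG.mul_sub_le_of_le_measureReal hC hR hS hfew h0 h1
    ((one_add_pow_le (sq_nonneg τ) (by linarith)).trans (by linarith))
    (hG.third_le_measureReal hs (by linarith) hℓ hout) hrare
  refine mul_le_of_div_mul_le hα hb.le hC (by linarith) (by linarith) h0 hCm ?_ hw
    (hmain.trans_eq (by ring))
  linarith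

theorem sq_le_mul_sq_of_forall_mul_le {X y A : ℝ} (hX : 1 ≤ X) (hy : 0 ≤ y)
    (h : ∀ τ, 0 ≤ τ → τ < 1 → X * τ ^ 2 ≤ 1 / 800 → τ * y ≤ A) : y ^ 2 ≤ 800 * X * A ^ 2 := by
  set τ := √(1 / (800 * X))
  have hτ : τ ^ 2 = 1 / (800 * X) := Real.sq_sqrt (by positivity)
  have hτ1 : τ < 1 := by
    rw [Real.sqrt_lt' one_pos, div_lt_iff₀ (by positivity)]
    linarith
  have hle := h τ (Real.sqrt_nonneg _) hτ1 (by rw [hτ]; exact (by field_simp : _ = _).le)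
  have hsq : (τ * y) ^ 2 ≤ A ^ 2 := by gcongr
  rwa [mul_pow, hτ, div_mul_eq_mul_div, one_mul, div_le_iff₀' (by positivity)] at hsq

theorem WeightBounds.exists_forall_pow_mul_pow_le (hG : WeightBounds G a b α) (β : ℝ)
    {D p : ENNReal} (hD : D ≠ ⊤) (hp0 : p ≠ 0) (hp1 : p ≤ 1) : ∃ C, 0 < C ∧ ∀ ℓ, 40 ≤ ℓ →
      ∃ K k : ℕ, β * ℓ < K ∧ k + 1 ≤ ℓ / 10 ∧ D ^ K * G (tameWeights G C)ᶜ ^ k ≤ p := by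
  obtain ⟨M, hM⟩ := exists_nat_gt (40 * β)
  obtain ⟨C, hC, hlt⟩ := hG.exists_measure_compl_tameWeights_lt
    (ENNReal.div_pos hp0 (ENNReal.pow_ne_top hD (n := M)))
  have hle : D ^ M * G (tameWeights G C)ᶜ ≤ p := ENNReal.mul_le_of_le_div' hlt.le
  refine ⟨C, hC, fun ℓ hℓ => ?_⟩
  have hk : ⌊ℓ / 20⌋₊ ≤ ℓ / 20 := Nat.floor_le (by linarith)
  have hk' : ℓ / 40 ≤ ⌊ℓ / 20⌋₊ := by linarith [Nat.lt_floor_add_one (ℓ / 20)]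
  refine ⟨M * ⌊ℓ / 20⌋₊, ⌊ℓ / 20⌋₊, ?_, by linarith, ?_⟩
  · push_cast
    calc β * ℓ = 40 * β * (ℓ / 40) := by ring
      _ < M * (ℓ / 40) := by gcongr
      _ ≤ M * ⌊ℓ / 20⌋₊ := by gcongr
  · have hk0 : ⌊ℓ / 20⌋₊ ≠ 0 := (Nat.floor_pos.2 (by linarith)).ne'
    rw [pow_mul, ← mul_pow]
    exact (pow_le_of_le_one zero_le (hle.trans hp1) hk0).trans hle

theorem WeightBounds.exists_le_mul_pow (hG : WeightBounds G a b α) (hd : 2 ≤ d) :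
    ∃ B : ℝ, 0 < B ∧ ∀ (v : Fin d → ℤ) (r ℓ : ℝ), 1 ≤ r → B * r ≤ ℓ → ℓ ≤ ‖toEuclid v‖ →
      ∫ t, (geodesicCount (slabOutsideCyl v r ℓ) 0 v t : ℝ) ∂(iidLaw (Edge d) G) ≤ ℓ / 2 →
      ℓ ≤ B * r ^ (d + 1) := by
  have ha := hG.left_pos
  have hα := hG.rate_pos
  obtain ⟨C, hC, hfew⟩ := hG.exists_forall_pow_mul_pow_le (2 * b * d / a)
    (D := 2 * (3 ^ d + 1)) (p := ENNReal.ofReal (1 / 20)) (by finiteness) (by simp) (by norm_num)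
  obtain ⟨m, hm⟩ := exists_nat_gt (160 * C ^ 2 / α)
  have hm0 : 0 < m := Nat.cast_pos.1 (lt_of_le_of_lt (by positivity) hm)
  rw [div_lt_iff₀' hα] at hm
  refine ⟨max (400 * m) (1600 * 15 ^ d * (256 * b * m * C ^ 2) ^ 2), by positivity,
    fun v r ℓ hr hrℓ hℓ hout => ?_⟩
  have hrℓ' : 400 * m * r ≤ ℓ := le_trans (by gcongr; exact le_max_left _ _) hrℓ
  have hℓ400 : 400 ≤ ℓ := by
    have hm1 : (1 : ℝ) ≤ m := mod_cast hm0
    calc (400 : ℝ) = 400 * 1 * 1 := by norm_num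
      _ ≤ 400 * m * r := by gcongr
      _ ≤ ℓ := hrℓ'
  obtain ⟨K, k, hK, hk, hfew⟩ := hfew ℓ (by linarith)
  rw [div_mul_eq_mul_div, div_lt_iff₀' ha] at hK
  have hX : 1 ≤ 2 * 15 ^ d * (ℓ * r ^ (d - 1)) := by
    have h15 : (1 : ℝ) ≤ 15 ^ d := one_le_pow₀ (by norm_num)
    have hrpow : 1 ≤ r ^ (d - 1) := one_le_pow₀ hr
    exact one_le_mul_of_one_le_of_one_le (by linarith)
      (one_le_mul_of_one_le_of_one_le (by linarith) hrpow)
  have hsq := sq_le_mul_sq_of_forall_mul_le hX (by linarith) fun τ h0 h1 hτ =>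
    hG.tilt_mul_le hd hm0 hr hrℓ' hℓ hC hm.le hK hk hfew h0 h1 hτ hout
  rw [sq] at hsq
  calc ℓ ≤ 1600 * 15 ^ d * (256 * b * m * C ^ 2) ^ 2 * r ^ (d + 1) := by
        refine le_of_mul_le_mul_right (hsq.trans_eq ?_) (by linarith : 0 < ℓ)
        rw [show d + 1 = d - 1 + 2 by lia]
        ring
    _ ≤ _ := by gcongr; exact le_max_right _ _

theorem exists_forall_le_rpow {n : ℕ} (hn : n ≠ 0) {B : ℝ} (hB : 0 < B) : ∃ c ℓ₀ : ℝ, 0 < c ∧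
    1 ≤ ℓ₀ ∧ ∀ ℓ, ℓ₀ ≤ ℓ → 1 ≤ c * ℓ ^ (1 / (n : ℝ)) ∧ B * (c * ℓ ^ (1 / (n : ℝ))) ≤ ℓ ∧
      B * (c * ℓ ^ (1 / (n : ℝ))) ^ n < ℓ := by
  have hn0 : (0 : ℝ) < n := by positivity
  refine ⟨(1 / (2 * B)) ^ (1 / (n : ℝ)), max 1 (2 * B), by positivity, le_max_left _ _,
    fun ℓ hℓ => ?_⟩
  obtain ⟨hℓ1, hℓB⟩ := max_le_iff.1 hℓ
  have hy : 1 ≤ 1 / (2 * B) * ℓ := by rwa [one_div_mul_eq_div, one_le_div (by positivity)]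
  have hhalf : B * (1 / (2 * B) * ℓ) = ℓ / 2 := by field_simp
  rw [← Real.mul_rpow (by positivity) (by positivity)]
  refine ⟨Real.one_le_rpow hy (by positivity), ?_, ?_⟩
  · have hle : (1 / (2 * B) * ℓ) ^ (1 / (n : ℝ)) ≤ 1 / (2 * B) * ℓ :=
      Real.rpow_le_self_of_one_le hy
        (div_le_one_of_le₀ (Nat.one_le_cast.2 (Nat.pos_of_ne_zero hn)) hn0.le)
    calc B * (1 / (2 * B) * ℓ) ^ (1 / (n : ℝ)) ≤ B * (1 / (2 * B) * ℓ) := by gcongr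
      _ ≤ ℓ := by linarith
  · rw [← Real.rpow_natCast, ← Real.rpow_mul (by positivity), one_div_mul_cancel hn0.ne',
      Real.rpow_one]
    linarith

theorem WeightBounds.exists_half_le_integral_geodesicCount (hG : WeightBounds G a b α)
    (hd : 2 ≤ d) : ∃ c ℓ₀ : ℝ, 0 < c ∧ 1 ≤ ℓ₀ ∧ ∀ (v : Fin d → ℤ) (ℓ : ℝ),
      ℓ₀ ≤ ℓ → ℓ ≤ ‖toEuclid v‖ → ℓ / 2 ≤
        ∫ t, (geodesicCount (slabOutsideCyl v (c * ℓ ^ (1 / ((d : ℝ) + 1))) ℓ) 0 v t : ℝ)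
          ∂(iidLaw (Edge d) G) := by
  obtain ⟨B, hB, hbound⟩ := hG.exists_le_mul_pow hd
  obtain ⟨c, ℓ₀, hc, hℓ₀, hr⟩ := exists_forall_le_rpow d.succ_ne_zero hB
  refine ⟨c, ℓ₀, hc, hℓ₀, fun v ℓ hℓ hℓv => ?_⟩
  obtain ⟨hr1, hrℓ, hlt⟩ := hr ℓ hℓ
  rw [Nat.cast_succ] at hr1 hrℓ hlt
  by_contra! hout
  exact (hbound v _ ℓ hr1 hrℓ hℓv hout.le).not_gt hlt

theorem hasLaw_iidLaw {Ω : Type*} [MeasurableSpace Ω] {P : Measure Ω} {t : Edge d → Ω → ℝ}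
    (ht : ∀ e, HasLaw (t e) G P) (hind : iIndepFun t P) :
    HasLaw (fun ω e => t e ω) (iidLaw (Edge d) G) P :=
  hind.hasLaw_infinitePi ht (aemeasurable_pi_iff.2 fun e => (ht e).aemeasurable)

theorem exists_forall_le_log_pow {n : ℕ} (hn : n ≠ 0) (y : ℝ) :
    ∃ x₀, y ≤ x₀ ∧ ∀ x, x₀ ≤ x → y ≤ Real.log x ^ n := by
  obtain ⟨x₀, hx₀⟩ := Filter.eventually_atTop.1 <|
    ((Filter.tendsto_pow_atTop hn).comp Real.tendsto_log_atTop).eventually_ge_atTop y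
  exact ⟨max y x₀, le_max_left _ _, fun x hx => hx₀ x ((le_max_right _ _).trans hx)⟩

end OutsideCylinder

end FPP

theorem theorem1p4_general (d : ℕ) (hd : 2 ≤ d) (G : Measure ℝ) [IsProbabilityMeasure G]
    (hG : FPP.WeightAssumption G) :
    ∃ c ℓ₀ : ℝ, 0 < c ∧ 1 ≤ ℓ₀ ∧
      ∀ (Ω : Type*) [MeasurableSpace Ω] (P : Measure Ω) [IsProbabilityMeasure P]
        (t : FPP.Edge d → Ω → ℝ),
        (∀ e, HasLaw (t e) G P) → iIndepFun t P →
        ∀ v : Fin d → ℤ, ℓ₀ ≤ ‖FPP.toEuclid v‖ →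
          (∀ ℓ : ℝ, ℓ₀ ≤ ℓ → ℓ ≤ ‖FPP.toEuclid v‖ →
            ℓ / 2 ≤ ∫ ω, (({u ∈ FPP.geodesicVertices (fun e => t e ω) 0 v |
                  0 ≤ inner ℝ (FPP.toEuclid u) (‖FPP.toEuclid v‖⁻¹ • FPP.toEuclid v) ∧
                  inner ℝ (FPP.toEuclid u) (‖FPP.toEuclid v‖⁻¹ • FPP.toEuclid v) ≤ ℓ ∧
                  FPP.toEuclid u ∉
                    FPP.cyl (FPP.toEuclid v) (c * ℓ ^ (1 / ((d : ℝ) + 1)))}.ncard : ℕ) : ℝ) ∂P) ∧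
          ‖FPP.toEuclid v‖ / 2 ≤ ∫ ω, (({u ∈ FPP.geodesicVertices (fun e => t e ω) 0 v |
                  FPP.toEuclid u ∉ FPP.cyl (FPP.toEuclid v)
                    (c * ‖FPP.toEuclid v‖ ^ (1 / ((d : ℝ) + 1)))}.ncard : ℕ) : ℝ) ∂P := by
  obtain ⟨a, b, α, hG⟩ := hG.exists_weightBounds
  obtain ⟨c, ℓ₀, hc, hℓ₀, hslab⟩ := hG.exists_half_le_integral_geodesicCount hd
  refine ⟨c, ℓ₀, hc, hℓ₀, fun Ω _ P _ t ht hind v hv => ?_⟩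
  have hlaw := FPP.integral_geodesicCount_comp (FPP.hasLaw_iidLaw ht hind)
  refine ⟨fun ℓ hℓ hℓv => (hslab v ℓ hℓ hℓv).trans (hlaw _ 0 v).ge,
    (hslab v _ hv le_rfl).trans (le_trans ?_ (hlaw (FPP.toEuclid ⁻¹' _ᶜ) 0 v).ge)⟩
  refine integral_mono (hG.integrable_geodesicCount _ 0 v) (hG.integrable_geodesicCount _ 0 v) ?_
  exact fun t => Nat.cast_le.2 (FPP.geodesicCount_mono (fun u hu => hu.2.2) 0 v t)

theorem theorem1p4 (d : ℕ) (hd : 2 ≤ d) (G : Measure ℝ) [IsProbabilityMeasure G]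
    (hG : FPP.WeightAssumption G) :
    ∃ c n₀ : ℝ, 0 < c ∧ 1 ≤ n₀ ∧
      ∀ (Ω : Type*) [MeasurableSpace Ω] (P : Measure Ω) [IsProbabilityMeasure P]
        (t : FPP.Edge d → Ω → ℝ),
        (∀ e, HasLaw (t e) G P) → iIndepFun t P →
        ∀ v : Fin d → ℤ, n₀ ≤ ‖FPP.toEuclid v‖ →
          (∀ ℓ : ℝ, Real.log ‖FPP.toEuclid v‖ ^ (d + 2) ≤ ℓ → ℓ ≤ ‖FPP.toEuclid v‖ →
            ℓ / 2 ≤ ∫ ω, (({u ∈ FPP.geodesicVertices (fun e => t e ω) 0 v |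
                  0 ≤ inner ℝ (FPP.toEuclid u) (‖FPP.toEuclid v‖⁻¹ • FPP.toEuclid v) ∧
                  inner ℝ (FPP.toEuclid u) (‖FPP.toEuclid v‖⁻¹ • FPP.toEuclid v) ≤ ℓ ∧
                  FPP.toEuclid u ∉
                    FPP.cyl (FPP.toEuclid v) (c * ℓ ^ (1 / ((d : ℝ) + 1)))}.ncard : ℕ) : ℝ) ∂P) ∧
          ‖FPP.toEuclid v‖ / 2 ≤ ∫ ω, (({u ∈ FPP.geodesicVertices (fun e => t e ω) 0 v |
                  FPP.toEuclid u ∉ FPP.cyl (FPP.toEuclid v)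
                    (c * ‖FPP.toEuclid v‖ ^ (1 / ((d : ℝ) + 1)))}.ncard : ℕ) : ℝ) ∂P := by
  obtain ⟨c, ℓ₀, hc, hℓ₀, hmain⟩ := theorem1p4_general d hd G hG
  obtain ⟨n₀, hn₀, hlog⟩ := FPP.exists_forall_le_log_pow (n := d + 2) (by lia) ℓ₀
  exact ⟨c, n₀, hc, hℓ₀.trans hn₀, fun Ω _ P _ t ht hind v hv =>
    (hmain Ω P t ht hind v (hn₀.trans hv)).imp_left fun h ℓ hℓ => h ℓ ((hlog _ hv).trans hℓ)⟩
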